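/- For integers $a,b$ and $n\ge 1$ let $$S(a,b;n)=\sum_{\substack{x \bmod n\\ x\bar x\equiv 1 \bmod n}} e^{2\pi i (ax+b\bar x)/n}$$ be the Kloosterman sum. For real $X$ let $\pi(X)$ be the number of primes $p\le X$, let $\omega(n)$ be the number of distinct prime factors of $n$, let $\pi_k(X)$ be the number of square-free $n\le X$ with $\omega(n)=k$, and for $k\ge 2$ let $L_k$ be the product of the first $k-1$ primes. Theorem. Let $a\neq 0$, $b\neq 0$ and $k\ge 2$ be integers. Then for every complex number $\eta\ne 0$ and every multiplicative function $f:\mathbb{N}\to\mathbb{C}$ the following hold. (i) For all real $X\ge 1$, $$\bigl|\{n\le X: S(a,b;n)=\eta f(n),\ n \text{ square-free},\ \omega(n)=k\}\bigr|\le \pi\Bigl(\frac{X}{L_k}\Bigr)+7\bigl(|a|+|b|+\sqrt{k}\bigr)X^{1-\frac{1}{2k}}.$$ (ii) As $X\to+\infty$, $$\bigl|\{n\le X: S(a,b;n)\ne\eta f(n),\ n \text{ square-free},\ \omega(n)=k\}\bigr|= \pi_k(X)+O\Bigl(\pi\Bigl(\frac{X}{L_k}\Bigr)\Bigr),$$ where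 the implied constant, and the point from which the estimate holds, depend only on $a,b,k$ (not on $\eta$ or $f$). (iii) $S(a,b;n)\neq\eta f(n)$ holds for $100\%$ of the square-free $n$ with $\omega(n)=k$, that is, $$\lim_{X\to+\infty}\frac{\bigl|\{n\le X: S(a,b;n)\ne\eta f(n),\ n \text{ square-free},\ \omega(n)=k\}\bigr|}{\pi_k(X)}=1.$$ -/

import Mathlib

/-- The Kloosterman sum `S(a, b; c) = ∑ e((a x + b x̄) / c)`, over the invertible residue classes
`x` modulo `c`, with `x̄` the inverse of `x` modulo `c` and `e(t) = exp(2πit)`. Here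
`ZMod.stdAddChar` sends the class of an integer `j` modulo `c` to `exp(2πij/c)`. The sum is
defined for `c ≥ 1`; the value at `c = 0` is set to `0` and plays no role. -/
noncomputable def kloosterman (a b : ℤ) (c : ℕ) : ℂ :=
  if h : c = 0 then 0
  else
    haveI : NeZero c := ⟨h⟩
    ∑ x : (ZMod c)ˣ,
      ZMod.stdAddChar ((a : ZMod c) * (x : ZMod c) + (b : ZMod c) * ((x⁻¹ : (ZMod c)ˣ) : ZMod c))

/-- `Π_k(X)`: the square-free `n ≤ X` with exactly `k` prime factors. -/
def squarefreeAlmostPrimes (k : ℕ) (X : ℝ) : Set ℕ :=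
  {n : ℕ | (n : ℝ) ≤ X ∧ Squarefree n ∧ ArithmeticFunction.cardDistinctFactors n = k}

/-- `L_k`: the product of the first `k - 1` primes (used for `k ≥ 2`). -/
noncomputable def primorialL (k : ℕ) : ℕ :=
  ∏ i ∈ Finset.range (k - 1), Nat.nth Nat.Prime i

/-- `π(X)`: the number of primes `p ≤ X`, for real `X`. -/
noncomputable def primePi (X : ℝ) : ℕ :=
  {p : ℕ | (p : ℝ) ≤ X ∧ p.Prime}.ncard

/-! Write a square-free n with k prime factors as n = p m, p its largest prime, and join p to m when
S(a,b;pm) = η f(pm). For p ∤ 6ab this bipartite graph is sparse. On a 4-cycle {p, p'} × {m, m'}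
multiplicativity eliminates η and f: S(pm) S(p'm') = S(pm') S(p'm). Twisted multiplicativity turns
this into a proportionality, over a cyclotomic field of conductor prime to p, between S(ua, ub; p)
and S(u'a, u'b; p), where u, u' invert m, m' mod p. Such sums are independent unless the products of
their parameters agree (`mul_eq_mul_of_kloosterman_mul_eq`), so m² ≡ m'² mod p.

Hence all common neighbours of m ≠ m', once there are two, divide the nonzero number m² - m'². They
exceed the prime factors of m and m', so there are at most 2k of them
(`KloostermanEdge.card_common_le`). A weighted Kővári–Sós–Turán argument
(`sum_card_le_of_card_common_le`) bounds the edges by the number of p of positive degree plus 7√k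
X^{1-1/(2k)}. Since m ≥ L_k, such p are at most X/L_k, which gives (i); primes dividing 6ab are
counted trivially.

Chebyshev's bounds let π(X/L_k) absorb the power-saving error, which gives (ii). Divergence of Σ 1/q
gives π(X) = o(π_k(X)), hence (iii). -/

/-! ### Linear relations between p-th roots of unity over ℚ(ζ_N) -/

open Polynomial IntermediateField in
/-- The minimal polynomial of a primitive `p`-th root of unity over `ℚ(ζ_N)` still has degree
`p - 1` when `p ∤ N`. -/
theorem natDegree_minpoly_adjoin_primitiveRoot {p N : ℕ} (hp : p.Prime) (hN : N ≠ 0) (hpN : ¬ p ∣ N)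
    {ζ ξ : ℂ} (hζ : IsPrimitiveRoot ζ p) (hξ : IsPrimitiveRoot ξ N) :
    p - 1 ≤ (minpoly ℚ⟮ξ⟯ ζ).natDegree := by
  have hξi : IsIntegral ℚ ξ := (hξ.isIntegral (Nat.pos_of_ne_zero hN)).tower_top
  have hζi : IsIntegral ℚ⟮ξ⟯ ζ := (hζ.isIntegral hp.pos).tower_top
  set K := ℚ⟮ξ⟯ with hK
  have : FiniteDimensional ℚ K := adjoin.finiteDimensional hξi
  have : FiniteDimensional K K⟮ζ⟯ := adjoin.finiteDimensional hζi
  have : FiniteDimensional ℚ K⟮ζ⟯ := FiniteDimensional.trans ℚ K K⟮ζ⟯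
  have h1 : Module.finrank ℚ K = N.totient := by
    rw [hK, adjoin.finrank hξi, ← cyclotomic_eq_minpoly_rat hξ (Nat.pos_of_ne_zero hN),
      natDegree_cyclotomic]
  have h2 : Module.finrank K K⟮ζ⟯ = (minpoly K ζ).natDegree := adjoin.finrank hζi
  have hx : IsPrimitiveRoot (algebraMap K K⟮ζ⟯ (AdjoinSimple.gen ℚ ξ)) N := by
    rw [← IsPrimitiveRoot.map_iff_of_injective (f := algebraMap K⟮ζ⟯ ℂ)
      (algebraMap K⟮ζ⟯ ℂ).injective]
    exact hξ
  have hy : IsPrimitiveRoot (AdjoinSimple.gen K ζ) p := by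
    rw [← IsPrimitiveRoot.map_iff_of_injective (f := algebraMap K⟮ζ⟯ ℂ)
      (algebraMap K⟮ζ⟯ ℂ).injective]
    simpa using hζ
  have hcop : Nat.Coprime p N := (Nat.Prime.coprime_iff_not_dvd hp).2 hpN
  -- The compositum contains roots of unity of orders p and N, so its degree over ℚ is at least
  -- φ(pN) = (p - 1) φ(N); the tower law removes φ(N).
  have h3 := hy.lcm_totient_le_finrank hx
    (cyclotomic.irreducible_rat (Nat.lcm_pos hp.pos (Nat.pos_of_ne_zero hN)))
  rw [hcop.lcm_eq_mul, Nat.totient_mul hcop, Nat.totient_prime hp,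
    ← Module.finrank_mul_finrank ℚ K K⟮ζ⟯, h1, h2, mul_comm] at h3
  exact Nat.le_of_mul_le_mul_left h3 (Nat.totient_pos.2 (Nat.pos_of_ne_zero hN))

open Polynomial IntermediateField in
/-- The only `ℚ(ζ_N)`-linear relation among the `p`-th roots of unity, `p ∤ N`, is that their sum
vanishes. -/
theorem eq_of_sum_mul_stdAddChar_eq_zero {p N : ℕ} [hp : Fact p.Prime] (hN : N ≠ 0) (hpN : ¬ p ∣ N)
    {ξ : ℂ} (hξ : IsPrimitiveRoot ξ N) (d : ZMod p → ℂ) (hd : ∀ t, d t ∈ ℚ⟮ξ⟯)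
    (h : ∑ t, d t * ZMod.stdAddChar t = 0) (s t : ZMod p) : d s = d t := by
  have hp' := hp.out
  set K := ℚ⟮ξ⟯ with hK
  set ζ : ℂ := ZMod.stdAddChar (1 : ZMod p) with hζ0
  have hpow : ∀ t : ZMod p, (ZMod.stdAddChar t : ℂ) = ζ ^ t.val := fun t ↦ by
    rw [hζ0, ← AddChar.map_nsmul_eq_pow]; simp
  have hζ : IsPrimitiveRoot ζ p := by
    have h0 : ζ = Complex.exp (2 * Real.pi * Complex.I / p) := by
      have := ZMod.stdAddChar_coe (N := p) 1
      simpa using this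
    rw [h0]; exact Complex.isPrimitiveRoot_exp p hp'.ne_zero
  have hdeg := natDegree_minpoly_adjoin_primitiveRoot hp' hN hpN hζ hξ
  choose e he using fun t ↦ show ∃ e : K, (e : ℂ) = d t from ⟨⟨d t, hd t⟩, rfl⟩
  have hsum : ∑ t : ZMod p, ζ ^ t.val = 0 := by
    rw [← AddChar.sum_eq_zero_of_ne_one (R := ZMod p) (ψ := (ZMod.stdAddChar : AddChar (ZMod p) ℂ))]
    · simp [hpow]
    · intro h1
      have : ζ = 1 := by rw [hζ0, h1]; simp
      exact hζ.ne_one hp'.one_lt this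
  -- The class -1 carries the top exponent p - 1. Subtracting d(u) times the vanishing sum of all
  -- powers of ζ leaves a polynomial of degree below p - 1 that kills ζ, hence zero.
  set u : ZMod p := -1 with hu
  let Q : K[X] := ∑ t : ZMod p, C (e t - e u) * X ^ t.val
  have hQ0 : aeval ζ Q = 0 := by
    have : aeval ζ Q = ∑ t, (d t * ζ ^ t.val) - d u * ∑ t : ZMod p, ζ ^ t.val := by
      rw [Finset.mul_sum, ← Finset.sum_sub_distrib]
      simp only [Q, map_sum, map_mul, aeval_C, map_pow, aeval_X, map_sub]
      refine Finset.sum_congr rfl fun t _ ↦ ?_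
      rw [← he t, ← he u]
      exact sub_mul _ _ _
    rw [this, hsum]
    simpa [hpow] using h
  have hval : u.val = p - 1 := by
    rw [hu, ZMod.neg_val]
    have : Fact (1 < p) := ⟨hp'.one_lt⟩
    simp [ZMod.val_one]
  have hQ1 : Q.degree < (minpoly K ζ).degree := by
    have hζi : IsIntegral K ζ := (hζ.isIntegral hp'.pos).tower_top
    rw [degree_eq_natDegree (minpoly.ne_zero hζi)]
    refine lt_of_lt_of_le ?_ (Nat.cast_le.2 hdeg)
    refine (degree_sum_le _ _).trans_lt ?_
    rw [Finset.sup_lt_iff (WithBot.bot_lt_coe _)]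
    intro t _
    by_cases htu : t = u
    · simp [htu]
    refine (degree_C_mul_X_pow_le _ _).trans_lt (Nat.cast_lt.2 ?_)
    have h1 := ZMod.val_lt t
    have h2 : t.val ≠ u.val := fun h ↦ htu (ZMod.val_injective p h)
    omega
  have hQ : Q = 0 := by
    by_contra hne
    exact absurd (minpoly.degree_le_of_ne_zero K ζ hne hQ0) (not_le.2 hQ1)
  have key : ∀ t, e t = e u := by
    intro t
    have : Q.coeff t.val = e t - e u := by
      simp only [Q, finsetSum_coeff, coeff_C_mul, coeff_X_pow]
      rw [Finset.sum_eq_single t]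
      · simp
      · intro b _ hb
        rw [if_neg fun h ↦ hb (ZMod.val_injective p h.symm), mul_zero]
      · simp
    rw [hQ, coeff_zero] at this
    exact sub_eq_zero.1 this.symm
  rw [← he s, ← he t, key s, key t]

/-! ### Twisted multiplicativity and fields of definition -/

theorem kloosterman_eq_sum (a b : ℤ) (n : ℕ) [hn : NeZero n] :
    kloosterman a b n = ∑ x : (ZMod n)ˣ,
      ZMod.stdAddChar ((a : ZMod n) * (x : ZMod n) + (b : ZMod n) * ((x⁻¹ : (ZMod n)ˣ) : ZMod n)) := by
  rw [kloosterman, dif_neg hn.out]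

/-- Additive characters modulo `m * n` factor through the Chinese remainder theorem. -/
theorem ZMod.stdAddChar_mul_eq {m n : ℕ} [NeZero m] [NeZero n] {u v : ℤ} (huv : u * n + v * m = 1)
    (z : ZMod (m * n)) :
    (ZMod.stdAddChar z : ℂ) =
      ZMod.stdAddChar ((u : ZMod m) * ZMod.castHom (dvd_mul_right m n) (ZMod m) z) *
      ZMod.stdAddChar ((v : ZMod n) * ZMod.castHom (dvd_mul_left n m) (ZMod n) z) := by
  obtain ⟨j, rfl⟩ := ZMod.intCast_surjective z
  rw [map_intCast (ZMod.castHom (dvd_mul_right m n) (ZMod m)),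
    map_intCast (ZMod.castHom (dvd_mul_left n m) (ZMod n)), ← Int.cast_mul, ← Int.cast_mul,
    ZMod.stdAddChar_coe, ZMod.stdAddChar_coe, ZMod.stdAddChar_coe, ← Complex.exp_add]
  congr 1
  have hm : (m : ℂ) ≠ 0 := Nat.cast_ne_zero.2 (NeZero.ne m)
  have hn : (n : ℂ) ≠ 0 := Nat.cast_ne_zero.2 (NeZero.ne n)
  have h : (u : ℂ) * n + v * m = 1 := by exact_mod_cast huv
  push_cast
  field_simp
  linear_combination (-j : ℂ) * h

/-- Twisted multiplicativity of Kloosterman sums. -/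
theorem kloosterman_mul (a b : ℤ) {m n : ℕ} (hm : m ≠ 0) (hn : n ≠ 0) {u v : ℤ}
    (huv : u * n + v * m = 1) :
    kloosterman a b (m * n) =
      kloosterman (u * a) (u * b) m * kloosterman (v * a) (v * b) n := by
  have : NeZero m := ⟨hm⟩
  have : NeZero n := ⟨hn⟩
  have hcop : m.Coprime n := by
    rw [← Nat.isCoprime_iff_coprime]
    exact ⟨v, u, by linarith⟩
  rw [kloosterman_eq_sum, kloosterman_eq_sum, kloosterman_eq_sum, Finset.sum_mul_sum,
    ← Fintype.sum_prod_type']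
  refine Fintype.sum_equiv
    ((Units.mapEquiv (ZMod.chineseRemainder hcop).toMulEquiv).trans MulEquiv.prodUnits).toEquiv
    _ _ fun x ↦ ?_
  -- Ring homomorphisms out of `ZMod (m * n)` are unique, so the Chinese remainder projections are
  -- the reductions.
  have h1 : ∀ z, (ZMod.chineseRemainder hcop z).1 = ZMod.castHom (dvd_mul_right m n) (ZMod m) z :=
    fun z ↦ RingHom.congr_fun (Subsingleton.elim
      ((RingHom.fst _ _).comp (ZMod.chineseRemainder hcop).toRingHom) _) z
  have h2 : ∀ z, (ZMod.chineseRemainder hcop z).2 = ZMod.castHom (dvd_mul_left n m) (ZMod n) z :=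
    fun z ↦ RingHom.congr_fun (Subsingleton.elim
      ((RingHom.snd _ _).comp (ZMod.chineseRemainder hcop).toRingHom) _) z
  have h3 : ∀ y : (ZMod (m * n))ˣ, ((ZMod.chineseRemainder hcop) (y : ZMod (m * n))).1 =
    ((((Units.mapEquiv (ZMod.chineseRemainder hcop).toMulEquiv).trans
      MulEquiv.prodUnits).toEquiv y).1 : ZMod m) := fun _ ↦ rfl
  have h4 : ∀ y : (ZMod (m * n))ˣ, ((ZMod.chineseRemainder hcop) (y : ZMod (m * n))).2 =
    ((((Units.mapEquiv (ZMod.chineseRemainder hcop).toMulEquiv).trans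
      MulEquiv.prodUnits).toEquiv y).2 : ZMod n) := fun _ ↦ rfl
  have h5 : ∀ y : (ZMod (m * n))ˣ, ((Units.mapEquiv (ZMod.chineseRemainder hcop).toMulEquiv).trans
      MulEquiv.prodUnits).toEquiv y⁻¹ = (((Units.mapEquiv
        (ZMod.chineseRemainder hcop).toMulEquiv).trans MulEquiv.prodUnits).toEquiv y)⁻¹ :=
    fun _ ↦ map_inv ((Units.mapEquiv (ZMod.chineseRemainder hcop).toMulEquiv).trans
      MulEquiv.prodUnits) _
  rw [ZMod.stdAddChar_mul_eq huv]
  congr 2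
  · rw [← h1, map_add, Prod.fst_add, map_mul, map_mul, Prod.fst_mul, Prod.fst_mul, h3, h3, h5,
      map_intCast, map_intCast, Prod.fst_intCast, Prod.fst_intCast]
    push_cast
    rw [Prod.fst_inv]
    ring
  · rw [← h2, map_add, Prod.snd_add, map_mul, map_mul, Prod.snd_mul, Prod.snd_mul, h4, h4, h5,
      map_intCast, map_intCast, Prod.snd_intCast, Prod.snd_intCast]
    push_cast
    rw [Prod.snd_inv]
    ring

-- Every term of the sum is an n-th root of unity, hence a power of ξ.
open IntermediateField in
theorem kloosterman_mem_adjoin (a b : ℤ) {n N : ℕ} (hN : N ≠ 0) (hn : n ∣ N) {ξ : ℂ}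
    (hξ : IsPrimitiveRoot ξ N) : kloosterman a b n ∈ ℚ⟮ξ⟯ := by
  have hn0 : n ≠ 0 := fun h ↦ hN (by simpa [h] using hn)
  have : NeZero n := ⟨hn0⟩
  have : NeZero N := ⟨hN⟩
  rw [kloosterman_eq_sum]
  refine sum_mem fun x _ ↦ ?_
  generalize (a : ZMod n) * (x : ZMod n) + (b : ZMod n) * ((x⁻¹ : (ZMod n)ˣ) : ZMod n) = t
  have ht : (ZMod.stdAddChar t : ℂ) ^ N = 1 := by
    obtain ⟨c, rfl⟩ := hn
    rw [← AddChar.map_nsmul_eq_pow]; simp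
  obtain ⟨i, -, hi⟩ := hξ.eq_pow_of_pow_eq_one ht
  rw [← hi]
  exact pow_mem (mem_adjoin_simple_self ℚ ξ) i

/-! ### Fibre counts and nonvanishing -/

/-- The number of units `x` modulo `n` with `a x + b x⁻¹ = t`. -/
noncomputable def kloostermanFiber (n : ℕ) [NeZero n] (a b : ℤ) (t : ZMod n) : ℕ :=
  (Finset.univ.filter fun x : (ZMod n)ˣ ↦
    (a : ZMod n) * (x : ZMod n) + (b : ZMod n) * ((x⁻¹ : (ZMod n)ˣ) : ZMod n) = t).card

theorem sum_kloostermanFiber_mul {R : Type*} [CommSemiring R] (n : ℕ) [NeZero n] (a b : ℤ)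
    (w : ZMod n → R) :
    ∑ t, (kloostermanFiber n a b t : R) * w t = ∑ x : (ZMod n)ˣ,
      w ((a : ZMod n) * (x : ZMod n) + (b : ZMod n) * ((x⁻¹ : (ZMod n)ˣ) : ZMod n)) := by
  rw [← Finset.sum_fiberwise_of_maps_to (t := Finset.univ) (g := fun x : (ZMod n)ˣ ↦
    (a : ZMod n) * (x : ZMod n) + (b : ZMod n) * ((x⁻¹ : (ZMod n)ˣ) : ZMod n)) (by simp)]
  refine Finset.sum_congr rfl fun t _ ↦ ?_
  rw [Finset.sum_congr rfl (g := fun _ ↦ w t) fun x hx ↦ by rw [(Finset.mem_filter.1 hx).2]]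
  rw [Finset.sum_const, nsmul_eq_mul, kloostermanFiber]

theorem kloosterman_eq_sum_fiber (a b : ℤ) (n : ℕ) [NeZero n] :
    kloosterman a b n = ∑ t, (kloostermanFiber n a b t : ℂ) * ZMod.stdAddChar t := by
  rw [sum_kloostermanFiber_mul, kloosterman_eq_sum]

theorem sum_kloostermanFiber (p : ℕ) [hp : Fact p.Prime] (a b : ℤ) :
    ∑ t, kloostermanFiber p a b t = p - 1 := by
  have := sum_kloostermanFiber_mul (R := ℕ) p a b (fun _ ↦ 1)
  simpa [ZMod.card_units_eq_totient, Nat.totient_prime hp.out] using this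

/-- A vanishing sum would force all p fibre counts to be equal (the case N = 1 of the rigidity of
relations), but they add up to p - 1, which p does not divide. -/
theorem kloosterman_prime_ne_zero (a b : ℤ) {p : ℕ} (hp : p.Prime) : kloosterman a b p ≠ 0 := by
  have : Fact p.Prime := ⟨hp⟩
  intro h
  rw [kloosterman_eq_sum_fiber] at h
  have key := eq_of_sum_mul_stdAddChar_eq_zero one_ne_zero
    (fun h ↦ hp.one_lt.ne' (Nat.dvd_one.1 h)) (IsPrimitiveRoot.one (M := ℂ)) _
    (fun t ↦ _root_.natCast_mem _ _) h
  have hsum := sum_kloostermanFiber p a b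
  rw [Finset.sum_congr rfl fun t _ ↦ show _ = kloostermanFiber p a b 0 by exact_mod_cast key t 0,
    Finset.sum_const, Finset.card_univ, ZMod.card, smul_eq_mul] at hsum
  have h1 := hp.two_le
  have h2 : p ∣ p - 1 := ⟨_, hsum.symm⟩
  have := Nat.le_of_dvd (by omega) h2
  omega

/-- Twisted multiplicativity splits off one prime at a time; the parameters change along the way, so
the induction is over all a, b. -/
theorem kloosterman_ne_zero_of_squarefree {n : ℕ} (hn : Squarefree n) (a b : ℤ) :
    kloosterman a b n ≠ 0 := by
  induction n using Nat.strong_induction_on generalizing a b with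
  | _ n ih =>
  by_cases h1 : n = 1
  · subst h1
    rw [kloosterman_eq_sum]
    simp [Subsingleton.elim _ (0 : ZMod 1)]
  obtain ⟨m, hm⟩ := Nat.minFac_dvd n
  have hp := Nat.minFac_prime h1
  set p := n.minFac
  have hn0 : n ≠ 0 := hn.ne_zero
  have hm0 : m ≠ 0 := by rintro rfl; exact hn0 (by simpa using hm)
  rw [hm] at hn
  have hcop : IsCoprime (p : ℤ) m := (Nat.isCoprime_iff_coprime).2 (Nat.coprime_of_squarefree_mul hn)
  obtain ⟨v, u, huv⟩ := hcop
  rw [hm, kloosterman_mul a b hp.ne_zero hm0 (u := u) (v := v) (by linarith)]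
  refine mul_ne_zero (kloosterman_prime_ne_zero _ _ hp) (ih m ?_ hn.of_mul_right _ _)
  rw [hm]
  nlinarith [hp.two_le, Nat.pos_of_ne_zero hm0]

/-! ### Independence of Kloosterman sums to a prime modulus -/

theorem sum_kloostermanFiber_cast (p : ℕ) [hp : Fact p.Prime] (a b : ℤ) :
    ∑ t, (kloostermanFiber p a b t : ZMod p) = -1 := by
  have := congrArg (Nat.cast : ℕ → ZMod p) (sum_kloostermanFiber p a b)
  push_cast [hp.out.one_le] at this
  simpa using this

/-- The second moment of the fibres recovers ab mod p. In Σ (ax + b/x)² the pure squares cancel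
because p - 1 ∤ 2, and the cross term 2ab occurs p - 1 ≡ -1 times. -/
theorem sum_kloostermanFiber_mul_sq {p : ℕ} [hp : Fact p.Prime] (hp5 : 5 ≤ p) (a b : ℤ) :
    ∑ t, (kloostermanFiber p a b t : ZMod p) * t ^ 2 = -(2 * a * b) := by
  rw [sum_kloostermanFiber_mul p a b (fun t ↦ t ^ 2)]
  have h2 : ¬ (p - 1 ∣ 2) := fun h ↦ by have := Nat.le_of_dvd two_pos h; omega
  have hs : ∑ x : (ZMod p)ˣ, (x : ZMod p) ^ 2 = 0 := by
    have := FiniteField.sum_pow_units (ZMod p) 2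
    rw [ZMod.card, if_neg h2] at this
    simpa using this
  have hs' : ∑ x : (ZMod p)ˣ, ((x⁻¹ : (ZMod p)ˣ) : ZMod p) ^ 2 = 0 := by
    rw [← hs]
    exact Fintype.sum_equiv (Equiv.inv _) _ _ fun x ↦ rfl
  have hx : ∀ x : (ZMod p)ˣ, ((a : ZMod p) * (x : ZMod p) + b * ((x⁻¹ : (ZMod p)ˣ) : ZMod p)) ^ 2 =
      a ^ 2 * (x : ZMod p) ^ 2 + b ^ 2 * ((x⁻¹ : (ZMod p)ˣ) : ZMod p) ^ 2 + 2 * a * b := fun x ↦ by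
    have := x.mul_inv
    linear_combination (2 * (a : ZMod p) * b) * this
  rw [Finset.sum_congr rfl fun x _ ↦ hx x, Finset.sum_add_distrib, Finset.sum_add_distrib,
    ← Finset.mul_sum, ← Finset.mul_sum, hs, hs']
  simp [ZMod.card_units_eq_totient, Nat.totient_prime hp.out, hp.out.one_le]

open IntermediateField in
/-- Kloosterman sums modulo `p` with parameters of different products are linearly independent
over `ℚ(ζ_N)`, `p ∤ N`. -/
theorem mul_eq_mul_of_kloosterman_mul_eq {p N : ℕ} [hp : Fact p.Prime] (hp5 : 5 ≤ p) (hN : N ≠ 0)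
    (hpN : ¬ p ∣ N) {ξ : ℂ} (hξ : IsPrimitiveRoot ξ N) {U V : ℂ} (hU : U ∈ ℚ⟮ξ⟯) (hV : V ∈ ℚ⟮ξ⟯)
    (hU0 : U ≠ 0) {a b a' b' : ℤ}
    (h : kloosterman a b p * U = kloosterman a' b' p * V) :
    (a * b : ZMod p) = a' * b' := by
  rw [kloosterman_eq_sum_fiber, kloosterman_eq_sum_fiber, Finset.sum_mul, Finset.sum_mul,
    ← sub_eq_zero, ← Finset.sum_sub_distrib] at h
  have key := eq_of_sum_mul_stdAddChar_eq_zero hN hpN hξ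
    (fun t ↦ kloostermanFiber p a b t * U - kloostermanFiber p a' b' t * V)
    (fun t ↦ sub_mem (mul_mem (_root_.natCast_mem _ _) hU) (mul_mem (_root_.natCast_mem _ _) hV))
    (by rw [← h]; exact Finset.sum_congr rfl fun t _ ↦ by ring)
  have key0 := fun t ↦ key t 0
  set f := kloostermanFiber p a b
  set g := kloostermanFiber p a' b'
  -- Integer weights 1 and t² give A U = B V and C U = D V with integers A, B, C, D. Eliminating U
  -- and V leaves A D = B C, which can be reduced mod p, where A ≡ B ≡ -1, C ≡ -2ab and D ≡ -2a'b'.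
  have hw : ∀ w : ZMod p → ℤ, ((∑ t, w t * (f t - f 0 : ℤ) : ℤ) : ℂ) * U =
      ((∑ t, w t * (g t - g 0 : ℤ) : ℤ) : ℂ) * V := fun w ↦ by
    push_cast
    rw [Finset.sum_mul, Finset.sum_mul]
    refine Finset.sum_congr rfl fun t _ ↦ ?_
    linear_combination (w t : ℂ) * key0 t
  have h0 := hw fun _ ↦ 1
  have h2 := hw fun t ↦ (t.val : ℤ) ^ 2
  set A := ∑ t, (1 : ℤ) * (f t - f 0 : ℤ) with hA
  set B := ∑ t, (1 : ℤ) * (g t - g 0 : ℤ) with hB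
  set C := ∑ t : ZMod p, (t.val : ℤ) ^ 2 * (f t - f 0 : ℤ) with hC
  set D := ∑ t : ZMod p, (t.val : ℤ) ^ 2 * (g t - g 0 : ℤ) with hD
  have hA' : (A : ZMod p) = -1 := by
    rw [hA]; push_cast
    simp [Finset.sum_sub_distrib, f, sum_kloostermanFiber_cast]
  have hB' : (B : ZMod p) = -1 := by
    rw [hB]; push_cast
    simp [Finset.sum_sub_distrib, g, sum_kloostermanFiber_cast]
  have hsq : ∑ t : ZMod p, t ^ 2 = 0 :=
    FiniteField.sum_pow_lt_card_sub_one (ZMod p) 2 (by rw [ZMod.card]; omega)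
  have hC' : (C : ZMod p) = -(2 * a * b) := by
    rw [hC, ← sum_kloostermanFiber_mul_sq hp5]; push_cast
    simp only [ZMod.natCast_val, ZMod.cast_id', id_eq, mul_sub, Finset.sum_sub_distrib]
    rw [← Finset.sum_mul, hsq]; simp [f, mul_comm]
  have hD' : (D : ZMod p) = -(2 * a' * b') := by
    rw [hD, ← sum_kloostermanFiber_mul_sq hp5]; push_cast
    simp only [ZMod.natCast_val, ZMod.cast_id', id_eq, mul_sub, Finset.sum_sub_distrib]
    rw [← Finset.sum_mul, hsq]; simp [g, mul_comm]
  have hB0 : (B : ℂ) ≠ 0 := by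
    intro h
    have : B = 0 := by exact_mod_cast h
    rw [this] at hB'
    simp at hB'
  have hdet : A * D = B * C := by
    have : ((A * D : ℤ) : ℂ) = (B * C : ℤ) := by
      apply mul_right_cancel₀ hU0
      push_cast
      linear_combination (D : ℂ) * h0 - B * h2
    exact_mod_cast this
  have := congrArg (Int.cast : ℤ → ZMod p) hdet
  push_cast at this
  rw [hA', hB', hC', hD'] at this
  have h2 : (2 : ZMod p) ≠ 0 := by
    intro h
    have : ((2 : ℕ) : ZMod p) = 0 := by exact_mod_cast h
    have := Nat.le_of_dvd two_pos ((ZMod.natCast_eq_zero_iff 2 p).1 this)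
    omega
  apply mul_left_cancel₀ h2
  linear_combination -this

/-! ### The bipartite graph and its 4-cycles -/

/-- Four values of a Kloosterman sum matching a multiplicative function on a 4-cycle
`{p, p'} × {m, m'}` force `m² ≡ m'²` modulo `p`. -/
theorem sq_eq_sq_of_kloosterman_cycle {a b : ℤ} {η : ℂ} {f : ArithmeticFunction ℂ}
    (hf : f.IsMultiplicative) {p p' m m' : ℕ} (hp : p.Prime) (hp' : p'.Prime) (hpp : p ≠ p')
    (hp5 : 5 ≤ p) (ha : ¬ (p : ℤ) ∣ a) (hb : ¬ (p : ℤ) ∣ b) (hm : Squarefree m)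
    (hm' : Squarefree m') (hpm : ¬ p ∣ m) (hpm' : ¬ p ∣ m') (hp'm : ¬ p' ∣ m) (hp'm' : ¬ p' ∣ m')
    (h1 : kloosterman a b (p * m) = η * f (p * m)) (h2 : kloosterman a b (p * m') = η * f (p * m'))
    (h3 : kloosterman a b (p' * m) = η * f (p' * m))
    (h4 : kloosterman a b (p' * m') = η * f (p' * m')) :
    (m : ZMod p) ^ 2 = (m' : ZMod p) ^ 2 := by
  have : Fact p.Prime := ⟨hp⟩
  have c1 := (Nat.Prime.coprime_iff_not_dvd hp).2 hpm
  have c2 := (Nat.Prime.coprime_iff_not_dvd hp).2 hpm'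
  have c3 := (Nat.Prime.coprime_iff_not_dvd hp').2 hp'm
  have c4 := (Nat.Prime.coprime_iff_not_dvd hp').2 hp'm'
  have hcyc : kloosterman a b (p * m) * kloosterman a b (p' * m') =
      kloosterman a b (p * m') * kloosterman a b (p' * m) := by
    rw [h1, h2, h3, h4, hf.map_mul_of_coprime c1, hf.map_mul_of_coprime c2,
      hf.map_mul_of_coprime c3, hf.map_mul_of_coprime c4]
    ring
  obtain ⟨v, u, huv⟩ := Nat.isCoprime_iff_coprime.2 c1
  obtain ⟨v', u', huv'⟩ := Nat.isCoprime_iff_coprime.2 c2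
  rw [kloosterman_mul a b hp.ne_zero hm.ne_zero (u := u) (v := v) (by linarith),
    kloosterman_mul a b hp.ne_zero hm'.ne_zero (u := u') (v := v') (by linarith),
    mul_assoc, mul_assoc] at hcyc
  -- All moduli left after splitting off p divide this N, which is prime to p.
  set N := p' * m * m' with hNdef
  have hN : N ≠ 0 := mul_ne_zero (mul_ne_zero hp'.ne_zero hm.ne_zero) hm'.ne_zero
  have hpN : ¬ p ∣ N := by
    rw [hNdef, hp.dvd_mul, hp.dvd_mul, Nat.prime_dvd_prime_iff_eq hp hp']
    tauto
  have hξ := Complex.isPrimitiveRoot_exp N hN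
  have hsq : Squarefree (p' * m') := (Nat.squarefree_mul c4).2 ⟨hp'.squarefree, hm'⟩
  have key := mul_eq_mul_of_kloosterman_mul_eq hp5 hN hpN hξ
    (mul_mem (kloosterman_mem_adjoin _ _ hN ⟨p' * m', by rw [hNdef]; ring⟩ hξ)
      (kloosterman_mem_adjoin _ _ hN ⟨m, by rw [hNdef]; ring⟩ hξ))
    (mul_mem (kloosterman_mem_adjoin _ _ hN ⟨p' * m, by rw [hNdef]; ring⟩ hξ)
      (kloosterman_mem_adjoin _ _ hN ⟨m', by rw [hNdef]⟩ hξ))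
    (mul_ne_zero (kloosterman_ne_zero_of_squarefree hm _ _)
      (kloosterman_ne_zero_of_squarefree hsq _ _)) hcyc
  have e1 : (u : ZMod p) * m = 1 := by
    have := congrArg (Int.cast : ℤ → ZMod p) huv
    push_cast at this
    simpa using this
  have e2 : (u' : ZMod p) * m' = 1 := by
    have := congrArg (Int.cast : ℤ → ZMod p) huv'
    push_cast at this
    simpa using this
  have ha' : (a : ZMod p) ≠ 0 := fun h ↦ ha ((ZMod.intCast_zmod_eq_zero_iff_dvd a p).1 h)
  have hb' : (b : ZMod p) ≠ 0 := fun h ↦ hb ((ZMod.intCast_zmod_eq_zero_iff_dvd b p).1 h)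
  push_cast at key
  have key2 : (u : ZMod p) ^ 2 = u' ^ 2 := by
    apply mul_right_cancel₀ (mul_ne_zero ha' hb')
    linear_combination key
  linear_combination (-(m : ZMod p) ^ 2 * (u' * m' + 1)) * e2 - (m : ZMod p) ^ 2 * m' ^ 2 * key2 +
    (m' : ZMod p) ^ 2 * (u * m + 1) * e1

/-- `n = p * m` with `p` the largest prime factor of the square-free `n` with `k` prime factors,
`p ∤ 6ab`, and the Kloosterman sum modulo `n` equals `η f(n)`. -/
structure KloostermanEdge (a b : ℤ) (k : ℕ) (η : ℂ) (f : ArithmeticFunction ℂ) (p m : ℕ) : Prop where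
  prime : p.Prime
  five_le : 5 ≤ p
  not_dvd_left : ¬ (p : ℤ) ∣ a
  not_dvd_right : ¬ (p : ℤ) ∣ b
  squarefree : Squarefree m
  card_primeFactors : m.primeFactors.card = k - 1
  lt_of_mem : ∀ q ∈ m.primeFactors, q < p
  eq : kloosterman a b (p * m) = η * f (p * m)

theorem Nat.le_pow_card_primeFactors {m p : ℕ} (hm : Squarefree m)
    (h : ∀ q ∈ m.primeFactors, q < p) : m ≤ p ^ m.primeFactors.card := by
  conv_lhs => rw [← Nat.prod_primeFactors_of_squarefree hm]
  exact Finset.prod_le_pow_card _ _ _ fun q hq ↦ (h q hq).le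

theorem KloostermanEdge.not_dvd {a b : ℤ} {k : ℕ} {η : ℂ} {f : ArithmeticFunction ℂ} {p m : ℕ}
    (h : KloostermanEdge a b k η f p m) : ¬ p ∣ m := fun hd ↦
  (h.lt_of_mem p (Nat.mem_primeFactors.2 ⟨h.prime, hd, h.squarefree.ne_zero⟩)).ne rfl

/-- Any two common neighbours close a 4-cycle, so every common neighbour divides m² - m'². This is
nonzero and less than the 2k-th power of the least common neighbour. -/
theorem KloostermanEdge.card_common_le {a b : ℤ} {k : ℕ} (hk : 2 ≤ k) {η : ℂ}
    {f : ArithmeticFunction ℂ} (hf : f.IsMultiplicative) {m m' : ℕ} (hmm : m ≠ m')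
    (s : Finset ℕ) (hs : ∀ p ∈ s, KloostermanEdge a b k η f p m ∧ KloostermanEdge a b k η f p m') :
    s.card ≤ 2 * k := by
  wlog hlt : m' < m generalizing m m'
  · exact this hmm.symm (fun p hp ↦ (hs p hp).symm) (by omega)
  by_cases h1 : s.card ≤ 1
  · omega
  push Not at h1
  have hdvd : ∀ p ∈ s, p ∣ m ^ 2 - m' ^ 2 := by
    intro p hp
    obtain ⟨p', hp', hne⟩ := Finset.exists_mem_ne h1 p
    obtain ⟨e1, e2⟩ := hs p hp
    obtain ⟨e3, e4⟩ := hs p' hp'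
    have := sq_eq_sq_of_kloosterman_cycle hf e1.prime e3.prime hne.symm e1.five_le e1.not_dvd_left
      e1.not_dvd_right e1.squarefree e2.squarefree e1.not_dvd e2.not_dvd e3.not_dvd e4.not_dvd
      e1.eq e2.eq e3.eq e4.eq
    rw [← Nat.modEq_iff_dvd' (Nat.pow_le_pow_left hlt.le 2), ← ZMod.natCast_eq_natCast_iff]
    push_cast
    exact this.symm
  have hprod : ∏ p ∈ s, p ∣ m ^ 2 - m' ^ 2 :=
    Finset.prod_primes_dvd _ (fun p hp ↦ (hs p hp).1.prime.prime) hdvd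
  have hne : s.Nonempty := Finset.card_pos.1 (by omega)
  -- The least common neighbour q bounds both sides: it exceeds every prime factor of m, so m ≤
  -- q^(k-1), and the product of the common neighbours is at least q^|s|.
  set q := s.min' hne
  have hq := (hs q (s.min'_mem hne)).1
  have hle : q ^ s.card ≤ ∏ p ∈ s, p := Finset.pow_card_le_prod _ _ _ fun p hp ↦ s.min'_le p hp
  have hpos : 0 < m ^ 2 - m' ^ 2 := Nat.sub_pos_of_lt (Nat.pow_lt_pow_left hlt two_ne_zero)
  have hmle : m ≤ q ^ (k - 1) := by
    have := Nat.le_pow_card_primeFactors hq.squarefree hq.lt_of_mem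
    rwa [hq.card_primeFactors] at this
  have hfin : q ^ s.card ≤ q ^ (2 * k) := calc
    q ^ s.card ≤ m ^ 2 - m' ^ 2 := hle.trans (Nat.le_of_dvd hpos hprod)
    _ ≤ m ^ 2 := Nat.sub_le _ _
    _ ≤ (q ^ (k - 1)) ^ 2 := Nat.pow_le_pow_left hmle 2
    _ = q ^ ((k - 1) * 2) := (pow_mul _ _ _).symm
    _ ≤ q ^ (2 * k) := Nat.pow_le_pow_right hq.prime.pos (by omega)
  exact (Nat.pow_le_pow_iff_right hq.prime.one_lt).1 hfin

/-! ### Elementary sums of n^(-3/2) and n^(-1/2) -/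

/-- A telescoping majorant of n^(-3/2); the constant 4 leaves room for the crude √(n+1) ≤ (3/2)√n.
-/
theorem one_div_mul_sqrt_le {n : ℕ} (hn : 1 ≤ n) :
    1 / ((n : ℝ) * √n) ≤ 4 / √n - 4 / √((n + 1 : ℕ) : ℝ) := by
  have h1 : (1 : ℝ) ≤ n := by exact_mod_cast hn
  set s := √(n : ℝ)
  set r := √((n + 1 : ℕ) : ℝ)
  have hs : s ^ 2 = n := Real.sq_sqrt (by positivity)
  have hr : r ^ 2 = n + 1 := by rw [Real.sq_sqrt (by positivity)]; push_cast; rfl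
  have hs1 : 1 ≤ s := Real.one_le_sqrt.2 h1
  have hr0 : 0 < r := Real.sqrt_pos.2 (by positivity)
  have hr1 : r ≤ 3 / 2 * s := by
    refine (pow_le_pow_iff_left₀ hr0.le (by positivity) two_ne_zero).1 ?_
    nlinarith
  have hd : (r - s) * (r + s) = 1 := by linear_combination hr - hs
  have hrs : 4 / s - 4 / r = 4 / (s * r * (r + s)) := by
    have : r + s ≠ 0 := by positivity
    field_simp
    linear_combination hd
  rw [hrs, ← hs, div_le_div_iff₀ (by positivity) (by positivity)]
  have : r * (r + s) ≤ 4 * s ^ 2 := by nlinarith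
  nlinarith

theorem sum_Ico_one_div_mul_sqrt_le {A : ℕ} (hA : 1 ≤ A) (B : ℕ) (hAB : A ≤ B) :
    ∑ n ∈ Finset.Ico A B, 1 / ((n : ℝ) * √n) ≤ 4 / √A - 4 / √B := by
  induction B, hAB using Nat.le_induction with
  | base => simp
  | succ B hB ih =>
    rw [Finset.sum_Ico_succ_top hB]
    linarith [one_div_mul_sqrt_le (hA.trans hB)]

/-- A discrete version of `∫ max(x, Y)^(-3/2) dx ≤ 5 Y^(-1/2)`. -/
theorem sum_one_div_max_mul_sqrt_le (P : Finset ℕ) (hP : ∀ p ∈ P, 1 ≤ p) {Y : ℝ} (hY : 1 ≤ Y) :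
    ∑ p ∈ P, 1 / (max (p : ℝ) Y * √(max (p : ℝ) Y)) ≤ 5 / √Y := by
  have hY0 : 0 < √Y := Real.sqrt_pos.2 (by linarith)
  rw [← Finset.sum_filter_add_sum_filter_not P (fun p ↦ (p : ℝ) ≤ Y)]
  have h1 : ∑ p ∈ P.filter (fun p : ℕ ↦ (p : ℝ) ≤ Y), 1 / (max (p : ℝ) Y * √(max (p : ℝ) Y)) ≤ 1 / √Y := by
    rw [Finset.sum_congr rfl (g := fun _ ↦ 1 / (Y * √Y)) fun p hp ↦ by
      rw [max_eq_right (Finset.mem_filter.1 hp).2], Finset.sum_const, nsmul_eq_mul]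
    have hc : ((P.filter fun p : ℕ ↦ (p : ℝ) ≤ Y).card : ℝ) ≤ Y := by
      have : P.filter (fun p : ℕ ↦ (p : ℝ) ≤ Y) ⊆ Finset.Icc 1 ⌊Y⌋₊ := fun p hp ↦ by
        rw [Finset.mem_filter] at hp
        exact Finset.mem_Icc.2 ⟨hP p hp.1, Nat.le_floor hp.2⟩
      have := Finset.card_le_card this
      rw [Nat.card_Icc, Nat.add_sub_cancel] at this
      exact (Nat.cast_le.2 this).trans (Nat.floor_le (by linarith))
    calc _ ≤ Y * (1 / (Y * √Y)) := by gcongr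
      _ = 1 / √Y := by field_simp
  have h2 : ∑ p ∈ P.filter (fun p : ℕ ↦ ¬ (p : ℝ) ≤ Y), 1 / (max (p : ℝ) Y * √(max (p : ℝ) Y)) ≤ 4 / √Y := by
    rw [Finset.sum_congr rfl (g := fun p : ℕ ↦ 1 / ((p : ℝ) * √p)) fun p hp ↦ by
      rw [max_eq_left (not_le.1 (Finset.mem_filter.1 hp).2).le]]
    set A := ⌊Y⌋₊ + 1
    have hYA : Y ≤ (A : ℕ) := by exact_mod_cast (Nat.lt_floor_add_one Y).le
    have hsub : P.filter (fun p : ℕ ↦ ¬ (p : ℝ) ≤ Y) ⊆ Finset.Ico A (A + P.sup id + 1) :=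
      fun p hp ↦ by
        rw [Finset.mem_filter, not_le] at hp
        have h1 := (Nat.floor_lt (by linarith)).2 hp.2
        have h2 : p ≤ P.sup id := Finset.le_sup (f := id) hp.1
        exact Finset.mem_Ico.2 ⟨h1, by omega⟩
    calc _ ≤ ∑ n ∈ Finset.Ico A (A + P.sup id + 1), 1 / ((n : ℝ) * √n) :=
          Finset.sum_le_sum_of_subset_of_nonneg hsub fun _ _ _ ↦ by positivity
      _ ≤ 4 / √A := by
          refine (sum_Ico_one_div_mul_sqrt_le (by omega) _ (by omega)).trans ?_
          rw [sub_le_self_iff]; positivity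
      _ ≤ 4 / √Y := by gcongr
  calc _ ≤ 1 / √Y + 4 / √Y := add_le_add h1 h2
    _ = 5 / √Y := by ring

theorem sum_Icc_one_div_sqrt_le (K : ℕ) : ∑ n ∈ Finset.Icc 1 K, 1 / √(n : ℝ) ≤ 2 * √K := by
  induction K with
  | zero => simp
  | succ K ih =>
    rw [Finset.sum_Icc_succ_top (by omega)]
    refine (add_le_add_left ih _).trans ?_
    set r := √((K + 1 : ℕ) : ℝ)
    have hr : r ^ 2 = K + 1 := by rw [Real.sq_sqrt (by positivity)]; push_cast; rfl
    have hs : √(K : ℝ) ^ 2 = K := Real.sq_sqrt (by positivity)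
    have hr0 : 0 < r := Real.sqrt_pos.2 (by positivity)
    have : 1 / r ≤ 2 * r - 2 * √K := by
      rw [div_le_iff₀ hr0]
      nlinarith [sq_nonneg (r - √(K : ℝ))]
    linarith

/-- Splitting by the larger variable, say m, leaves at most m terms m^(-3/2), that is m^(-1/2); the
diagonal is counted twice. -/
theorem sum_sum_one_div_max_le (K : ℕ) :
    ∑ m ∈ Finset.Icc 1 K, ∑ n ∈ Finset.Icc 1 K,
      1 / (max (m : ℝ) n * √(max (m : ℝ) n)) ≤ 4 * √K := by
  have key : ∀ m ∈ Finset.Icc 1 K, ∑ n ∈ Finset.Icc 1 K,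
      (if n ≤ m then 1 / ((m : ℝ) * √m) else 0) ≤ 1 / √(m : ℝ) := by
    intro m hm
    have hm1 : (0 : ℝ) < m := by exact_mod_cast (Finset.mem_Icc.1 hm).1
    rw [← Finset.sum_filter, Finset.sum_const, nsmul_eq_mul]
    have : (Finset.Icc 1 K).filter (fun n ↦ n ≤ m) ⊆ Finset.Icc 1 m := fun n hn ↦ by
      simp only [Finset.mem_filter, Finset.mem_Icc] at hn ⊢
      omega
    have := Finset.card_le_card this
    rw [Nat.card_Icc, Nat.add_sub_cancel] at this
    calc _ ≤ (m : ℝ) * (1 / ((m : ℝ) * √m)) := by gcongr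
      _ = 1 / √(m : ℝ) := by
        have := Real.sqrt_pos.2 hm1
        field_simp
  calc _ ≤ ∑ m ∈ Finset.Icc 1 K, ∑ n ∈ Finset.Icc 1 K,
        ((if n ≤ m then 1 / ((m : ℝ) * √m) else 0) +
          (if m ≤ n then 1 / ((n : ℝ) * √n) else 0)) := by
        refine Finset.sum_le_sum fun m _ ↦ Finset.sum_le_sum fun n _ ↦ ?_
        rcases le_total m n with h | h
        · rw [max_eq_right (Nat.cast_le.2 h), if_pos h]
          exact le_add_of_nonneg_left (by positivity)
        · rw [max_eq_left (Nat.cast_le.2 h), if_pos h]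
          exact le_add_of_nonneg_right (by positivity)
    _ = (∑ m ∈ Finset.Icc 1 K, ∑ n ∈ Finset.Icc 1 K,
          (if n ≤ m then 1 / ((m : ℝ) * √m) else 0)) +
        ∑ m ∈ Finset.Icc 1 K, ∑ n ∈ Finset.Icc 1 K,
          (if n ≤ m then 1 / ((m : ℝ) * √m) else 0) := by
        simp only [Finset.sum_add_distrib]
        congr 1
        exact Finset.sum_comm
    _ ≤ (∑ m ∈ Finset.Icc 1 K, 1 / √(m : ℝ)) + ∑ m ∈ Finset.Icc 1 K, 1 / √(m : ℝ) :=
        add_le_add (Finset.sum_le_sum key) (Finset.sum_le_sum key)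
    _ ≤ 4 * √K := by linarith [sum_Icc_one_div_sqrt_le K]

/-! ### The weighted Kővári–Sós–Turán bound -/

/-- AM-GM for d - 1. Treating the first edge apart gives the vertices of positive degree coefficient
exactly 1, as the main term π(X/L_k) requires; d(d-1) counts ordered pairs of distinct neighbours.
-/
theorem natCast_le_add_of_pos (d : ℕ) {l : ℝ} (hl : 0 < l) :
    (d : ℝ) ≤ (if 0 < d then 1 else 0) + l + d * (d - 1) / (4 * l) := by
  rcases Nat.eq_zero_or_pos d with rfl | hd
  · simpa using hl.le
  · rw [if_pos hd]
    have h1 : (1 : ℝ) ≤ d := by exact_mod_cast hd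
    have h2 : (d : ℝ) - 1 - l ≤ d * (d - 1) / (4 * l) := by
      rw [le_div_iff₀ (by positivity)]
      nlinarith [sq_nonneg (2 * l - (d - 1))]
    linarith

/-- A weighted Kővári–Sós–Turán bound: the number of edges `(p, m)`, `p m ≤ X`, `m Y ≤ X`, of a
bipartite graph in which distinct `m` have at most `2 k` common neighbours. -/
theorem sum_card_le_of_card_common_le (P : Finset ℕ) (N : ℕ → Finset ℕ) {k : ℕ} (hk : 0 < k)
    {X Y : ℝ} (hX : 1 ≤ X) (hY : 1 ≤ Y) (hP : ∀ p ∈ P, 1 ≤ p)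
    (hN : ∀ p ∈ P, ∀ m ∈ N p, 1 ≤ m ∧ (m : ℝ) * p ≤ X ∧ (m : ℝ) * Y ≤ X)
    (hcommon : ∀ m m', m ≠ m' → (P.filter fun p ↦ m ∈ N p ∧ m' ∈ N p).card ≤ 2 * k) :
    (∑ p ∈ P, ((N p).card : ℝ)) ≤
      ((P.filter fun p ↦ (N p).Nonempty).card : ℝ) + 7 * √k * (X / √Y) := by
  set z : ℕ → ℝ := fun p ↦ max (p : ℝ) Y with hz
  have hz0 : ∀ p, 0 < z p := fun p ↦ lt_of_lt_of_le (by linarith) (le_max_right _ _)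
  have hzs : ∀ p, 0 < √(z p) := fun p ↦ Real.sqrt_pos.2 (hz0 p)
  have hX0 : 0 < X := by linarith
  have hsX : 0 < √X := Real.sqrt_pos.2 hX0
  have hsY : 0 < √Y := Real.sqrt_pos.2 (by linarith)
  have hsk : 0 < √(k : ℝ) := Real.sqrt_pos.2 (by exact_mod_cast hk)
  -- The power z^(-3/2) makes Σ l(p) of size √k X/√Y and, through max(m, m') z(p) ≤ X, bounds 1/(4
  -- l(p)) by c max(m, m')^(-3/2), free of p. The two sums contribute 5 and 2, whence the 7.
  set l : ℕ → ℝ := fun p ↦ √k * X * (1 / (z p * √(z p))) with hl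
  have hl0 : ∀ p, 0 < l p := fun p ↦ by have := hz0 p; have := hzs p; positivity
  set K := ⌊X / Y⌋₊ with hK
  set c : ℝ := √X / (4 * √k) with hc
  have hc0 : 0 ≤ c := by positivity
  set F : ℕ → ℕ → ℝ := fun m n ↦ 1 / (max (m : ℝ) n * √(max (m : ℝ) n)) with hF
  have hF0 : ∀ m n, 0 ≤ F m n := fun m n ↦ by
    have : (0 : ℝ) ≤ max (m : ℝ) n := le_max_of_le_left (Nat.cast_nonneg _)
    positivity
  have hsub : ∀ p ∈ P, N p ⊆ Finset.Icc 1 K := fun p hp m hm ↦ by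
    obtain ⟨h1, -, h3⟩ := hN p hp m hm
    exact Finset.mem_Icc.2 ⟨h1, Nat.le_floor ((le_div_iff₀ (by linarith)).2 h3)⟩
  have hsecond : ∑ p ∈ P, ((N p).card : ℝ) * ((N p).card - 1) / (4 * l p) ≤
      2 * √k * (X / √Y) := by
    have step : ∀ p ∈ P, ((N p).card : ℝ) * ((N p).card - 1) / (4 * l p) ≤
        ∑ x ∈ (Finset.Icc 1 K).offDiag,
          if x.1 ∈ N p ∧ x.2 ∈ N p then c * F x.1 x.2 else 0 := by
      intro p hp
      have hfilt : (Finset.Icc 1 K).offDiag.filter (fun x ↦ x.1 ∈ N p ∧ x.2 ∈ N p) =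
          (N p).offDiag := by
        ext x
        simp only [Finset.mem_filter, Finset.mem_offDiag]
        exact ⟨fun h ↦ ⟨h.2.1, h.2.2, h.1.2.2⟩,
          fun h ↦ ⟨⟨hsub p hp h.1, hsub p hp h.2.1, h.2.2⟩, h.1, h.2.1⟩⟩
      rw [← Finset.sum_filter, hfilt]
      have hcard : ((N p).card : ℝ) * ((N p).card - 1) = (N p).offDiag.card := by
        rw [Finset.offDiag_card, Nat.cast_sub (Nat.le_mul_self _)]
        push_cast; ring
      rw [hcard, div_eq_mul_one_div, ← nsmul_eq_mul]
      refine Finset.card_nsmul_le_sum _ _ _ fun x hx ↦ ?_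
      rw [Finset.mem_offDiag] at hx
      obtain ⟨a1, a2, a3⟩ := hN p hp _ hx.1
      obtain ⟨b1, b2, b3⟩ := hN p hp _ hx.2.1
      have a1' : (1 : ℝ) ≤ x.1 := by exact_mod_cast a1
      set M : ℝ := max (x.1 : ℝ) x.2 with hM
      have hM0 : 0 < M := lt_of_lt_of_le (by linarith) (le_max_left _ _)
      have hMs : 0 < √M := Real.sqrt_pos.2 hM0
      have hMz : M * z p ≤ X := by
        rcases max_cases (x.1 : ℝ) x.2 with ⟨h, -⟩ | ⟨h, -⟩ <;>
          rcases max_cases (p : ℝ) Y with ⟨h', -⟩ | ⟨h', -⟩ <;>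
          simp only [hM, hz, h, h'] <;> assumption
      have hs : √M * √(z p) ≤ √X := by
        rw [← Real.sqrt_mul hM0.le]; exact Real.sqrt_le_sqrt hMz
      have e1 : 1 / (4 * l p) = (z p * √(z p)) / (4 * √k * X) := by
        have := hz0 p; have := hzs p
        simp only [hl]; field_simp
      have e2 : c * F x.1 x.2 = √X / (4 * √k * (M * √M)) := by
        simp only [hc, hF, ← hM]; field_simp
      rw [e1, e2, div_le_div_iff₀ (by positivity) (by positivity)]
      have := mul_le_mul hMz hs (by have := hzs p; positivity) hX0.le
      nlinarith
    calc _ ≤ ∑ p ∈ P, ∑ x ∈ (Finset.Icc 1 K).offDiag,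
          (if x.1 ∈ N p ∧ x.2 ∈ N p then c * F x.1 x.2 else 0) := Finset.sum_le_sum step
      _ = ∑ x ∈ (Finset.Icc 1 K).offDiag,
          ((P.filter fun p ↦ x.1 ∈ N p ∧ x.2 ∈ N p).card : ℝ) * (c * F x.1 x.2) := by
          rw [Finset.sum_comm]
          refine Finset.sum_congr rfl fun x _ ↦ ?_
          rw [← Finset.sum_filter, Finset.sum_const, nsmul_eq_mul]
      _ ≤ ∑ x ∈ (Finset.Icc 1 K).offDiag, (2 * k : ℝ) * (c * F x.1 x.2) := by
          refine Finset.sum_le_sum fun x hx ↦ ?_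
          have := hcommon x.1 x.2 (Finset.mem_offDiag.1 hx).2.2
          have h' : ((P.filter fun p ↦ x.1 ∈ N p ∧ x.2 ∈ N p).card : ℝ) ≤ 2 * k := by
            exact_mod_cast this
          exact mul_le_mul_of_nonneg_right h' (mul_nonneg hc0 (hF0 _ _))
      _ ≤ ∑ x ∈ Finset.Icc 1 K ×ˢ Finset.Icc 1 K, (2 * k : ℝ) * (c * F x.1 x.2) := by
          refine Finset.sum_le_sum_of_subset_of_nonneg ?_ fun x _ _ ↦ ?_
          · intro x hx
            rw [Finset.mem_offDiag] at hx
            exact Finset.mem_product.2 ⟨hx.1, hx.2.1⟩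
          · have := hF0 x.1 x.2
            positivity
      _ = 2 * k * c * ∑ m ∈ Finset.Icc 1 K, ∑ n ∈ Finset.Icc 1 K, F m n := by
          rw [Finset.sum_product, Finset.mul_sum]
          refine Finset.sum_congr rfl fun m _ ↦ ?_
          rw [Finset.mul_sum]
          exact Finset.sum_congr rfl fun n _ ↦ by ring
      _ ≤ 2 * k * c * (4 * √(X / Y)) := by
          gcongr
          refine (sum_sum_one_div_max_le K).trans ?_
          gcongr
          exact Nat.floor_le (by positivity)
      _ = 2 * √k * (X / √Y) := by
          rw [Real.sqrt_div hX0.le, hc]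
          have h1 : √(k : ℝ) * √k = k := Real.mul_self_sqrt (Nat.cast_nonneg _)
          have h2 : √X * √X = X := Real.mul_self_sqrt hX0.le
          field_simp
          nlinarith
  have hfirst : ∑ p ∈ P, l p ≤ 5 * √k * (X / √Y) := by
    simp only [hl]
    rw [← Finset.mul_sum]
    calc _ ≤ √k * X * (5 / √Y) := by
          gcongr
          exact sum_one_div_max_mul_sqrt_le P hP hY
      _ = 5 * √k * (X / √Y) := by ring
  calc _ ≤ ∑ p ∈ P, ((if 0 < (N p).card then 1 else 0) + l p +
        ((N p).card : ℝ) * ((N p).card - 1) / (4 * l p)) :=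
        Finset.sum_le_sum fun p _ ↦ natCast_le_add_of_pos _ (hl0 p)
    _ = ((P.filter fun p ↦ (N p).Nonempty).card : ℝ) + ∑ p ∈ P, l p +
        ∑ p ∈ P, ((N p).card : ℝ) * ((N p).card - 1) / (4 * l p) := by
        rw [Finset.sum_add_distrib, Finset.sum_add_distrib]
        congr 2
        simp [Finset.card_pos]
    _ ≤ _ := by linarith

/-! ### Products of primes and the largest prime factor -/

/-- Induction on the largest element q: the other elements are primes below q, so q is at least the
prime of index |S| - 1, counted from 0. -/
theorem prod_nth_prime_le_prod (S : Finset ℕ) (hS : ∀ p ∈ S, p.Prime) :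
    ∏ i ∈ Finset.range S.card, Nat.nth Nat.Prime i ≤ ∏ p ∈ S, p := by
  induction S using Finset.induction_on_max with
  | empty => simp
  | insert q S hq ih =>
    have hqS : q ∉ S := fun h ↦ (hq q h).ne rfl
    rw [Finset.card_insert_of_notMem hqS, Finset.prod_range_succ, Finset.prod_insert hqS, mul_comm]
    refine Nat.mul_le_mul ?_ (ih fun p hp ↦ hS p (Finset.mem_insert_of_mem hp))
    have hqp := hS q (Finset.mem_insert_self q S)
    conv_rhs => rw [← Nat.nth_count hqp]
    refine Nat.nth_monotone Nat.infinite_setOfPred_prime ?_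
    rw [Nat.count_eq_card_filter_range]
    exact Finset.card_le_card fun p hp ↦ Finset.mem_filter.2
      ⟨Finset.mem_range.2 (hq p hp), hS p (Finset.mem_insert_of_mem hp)⟩

theorem primorialL_le {k m : ℕ} (hm : Squarefree m) (hc : m.primeFactors.card = k - 1) :
    primorialL k ≤ m := by
  rw [primorialL, ← hc]
  conv_rhs => rw [← Nat.prod_primeFactors_of_squarefree hm]
  exact prod_nth_prime_le_prod _ fun p hp ↦ Nat.prime_of_mem_primeFactors hp

theorem primorialL_pos (k : ℕ) : 0 < primorialL k :=
  Finset.prod_pos fun i _ ↦ (Nat.prime_nth_prime i).pos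

theorem mem_squarefreeAlmostPrimes {k : ℕ} {X : ℝ} {n : ℕ} : n ∈ squarefreeAlmostPrimes k X ↔
    (n : ℝ) ≤ X ∧ Squarefree n ∧ n.primeFactors.card = k := by
  rw [squarefreeAlmostPrimes, Set.mem_ofPred_eq, ArithmeticFunction.cardDistinctFactors_apply,
    ← List.card_toFinset, Nat.primeFactors]

theorem finite_setOf_natCast_le (X : ℝ) : {n : ℕ | (n : ℝ) ≤ X}.Finite :=
  (Set.finite_Iic ⌊X⌋₊).subset fun _ hn ↦ Nat.le_floor hn

theorem finite_squarefreeAlmostPrimes (k : ℕ) (X : ℝ) : (squarefreeAlmostPrimes k X).Finite :=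
  (finite_setOf_natCast_le X).subset fun _ hn ↦ hn.1

/-- Splitting off the largest prime factor of a square-free number. -/
theorem exists_eq_largest_prime_mul {n : ℕ} (hn : Squarefree n) (hn1 : n ≠ 1) :
    ∃ p m : ℕ, n = p * m ∧ p.Prime ∧ Squarefree m ∧
      m.primeFactors.card = n.primeFactors.card - 1 ∧ ∀ q ∈ m.primeFactors, q < p := by
  have hne : n.primeFactors.Nonempty := Nat.nonempty_primeFactors.2 (by
    have := hn.ne_zero; omega)
  set p := n.primeFactors.max' hne with hpdef
  have hpm : p ∈ n.primeFactors := Finset.max'_mem _ _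
  have hp := Nat.prime_of_mem_primeFactors hpm
  obtain ⟨m, hm⟩ := Nat.dvd_of_mem_primeFactors hpm
  have hn' := hn
  rw [hm] at hn'
  have hcop := Nat.coprime_of_squarefree_mul hn'
  have hpnm : p ∉ m.primeFactors := fun h ↦
    (Nat.Prime.coprime_iff_not_dvd hp).1 hcop (Nat.dvd_of_mem_primeFactors h)
  have hins : n.primeFactors = insert p m.primeFactors := by
    rw [hm, hcop.primeFactors_mul, hp.primeFactors, Finset.insert_eq]
  refine ⟨p, m, hm, hp, hn'.of_mul_right, ?_, fun q hq ↦ ?_⟩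
  · rw [hins, Finset.card_insert_of_notMem hpnm, Nat.add_sub_cancel]
  · have h1 : q ≤ p := Finset.le_max' _ _ (by rw [hins]; exact Finset.mem_insert_of_mem hq)
    exact lt_of_le_of_ne h1 fun h ↦ hpnm (h ▸ hq)

theorem Nat.card_primeFactors_le_self (n : ℕ) : n.primeFactors.card ≤ n := by
  have : n.primeFactors ⊆ Finset.Icc 1 n := fun p hp ↦
    Finset.mem_Icc.2 ⟨(Nat.prime_of_mem_primeFactors hp).pos, Nat.le_of_mem_primeFactors hp⟩
  simpa using Finset.card_le_card this

theorem card_primeFactors_six_mul_le (a b : ℤ) :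
    ((6 * a.natAbs * b.natAbs).primeFactors.card : ℝ) ≤ 2 + |(a : ℝ)| + |(b : ℝ)| := by
  have h6 : (6 : ℕ).primeFactors.card ≤ 2 := by
    have : (6 : ℕ) = 2 * 3 := rfl
    rw [this, Nat.primeFactors_mul two_ne_zero three_ne_zero, Nat.prime_two.primeFactors,
      Nat.prime_three.primeFactors]
    exact Finset.card_union_le _ _
  have hmul : ∀ x y : ℕ, (x * y).primeFactors.card ≤ x.primeFactors.card + y.primeFactors.card := by
    intro x y
    rcases eq_or_ne x 0 with rfl | hx
    · simp
    rcases eq_or_ne y 0 with rfl | hy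
    · simp
    rw [Nat.primeFactors_mul hx hy]
    exact Finset.card_union_le _ _
  have h := (hmul (6 * a.natAbs) b.natAbs).trans (Nat.add_le_add (hmul 6 a.natAbs) le_rfl)
  have h' : (6 * a.natAbs * b.natAbs).primeFactors.card ≤ 2 + a.natAbs + b.natAbs :=
    h.trans (Nat.add_le_add (Nat.add_le_add h6 (Nat.card_primeFactors_le_self _))
      (Nat.card_primeFactors_le_self _))
  have := (Nat.cast_le (α := ℝ)).2 h'
  push_cast [Nat.cast_natAbs] at this
  exact this

/-- Gives m ≤ X/Y for Y = X^(1/k): if p ≥ Y use mp ≤ X, otherwise m ≤ Y^(k-1). -/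
theorem natCast_mul_le_of_le_pow {X Y : ℝ} {k m p : ℕ} (hk : 1 ≤ k) (hY : 0 < Y) (hXY : Y ^ k = X)
    (h1 : (m : ℝ) * p ≤ X) (h2 : m ≤ p ^ (k - 1)) : (m : ℝ) * Y ≤ X := by
  rcases le_total Y p with h | h
  · exact (mul_le_mul_of_nonneg_left h (Nat.cast_nonneg _)).trans h1
  · have : (m : ℝ) ≤ Y ^ (k - 1) := by
      calc (m : ℝ) ≤ (p : ℝ) ^ (k - 1) := by exact_mod_cast h2
        _ ≤ Y ^ (k - 1) := by gcongr
    calc (m : ℝ) * Y ≤ Y ^ (k - 1) * Y := by gcongr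
      _ = X := by rw [← pow_succ, Nat.sub_add_cancel hk, hXY]

/-! ### The upper bound (i) -/

/-- The number of square-free `n ≤ X` with `k` prime factors for which the Kloosterman sum
agrees with a multiple of a multiplicative function. -/
theorem ncard_kloosterman_eq_le {a b : ℤ} (ha : a ≠ 0) (hb : b ≠ 0) {k : ℕ} (hk : 2 ≤ k)
    (η : ℂ) {f : ArithmeticFunction ℂ} (hf : f.IsMultiplicative) {X : ℝ} (hX : 1 ≤ X) :
    ({n ∈ squarefreeAlmostPrimes k X | kloosterman a b n = η * f n}.ncard : ℝ) ≤
      (primePi (X / (primorialL k : ℝ)) : ℝ) +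
        7 * (|(a : ℝ)| + |(b : ℝ)| + √(k : ℝ)) * X ^ (1 - 1 / (2 * (k : ℝ))) := by
  classical
  have hX0 : 0 < X := by linarith
  have hk0 : (k : ℝ) ≠ 0 := by positivity
  set Y : ℝ := X ^ (1 / (k : ℝ)) with hYdef
  have hY1 : 1 ≤ Y := Real.one_le_rpow hX (by positivity)
  have hYX : Y ^ k = X := by
    rw [hYdef, ← Real.rpow_natCast, ← Real.rpow_mul hX0.le, one_div_mul_cancel hk0, Real.rpow_one]
  have hmain : X / √Y = X ^ (1 - 1 / (2 * (k : ℝ))) := by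
    rw [Real.sqrt_eq_rpow, hYdef, ← Real.rpow_mul hX0.le, Real.rpow_sub hX0, Real.rpow_one]
    congr 2
    field_simp
  set P : Finset ℕ := Finset.Icc 1 ⌊X⌋₊ with hP
  set N : ℕ → Finset ℕ := fun p ↦ (Finset.Icc 1 ⌊X⌋₊).filter fun m ↦
    KloostermanEdge a b k η f p m ∧ (m : ℝ) * p ≤ X with hN
  -- Exceptional primes, to which the cycle argument does not apply; each is paired with at most X/Y
  -- values of m.
  set B : Finset ℕ := (6 * a.natAbs * b.natAbs).primeFactors with hB
  set M : Finset ℕ := Finset.Icc 1 ⌊X / Y⌋₊ with hM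
  have hbound : ∀ p ∈ P, ∀ m ∈ N p, 1 ≤ m ∧ (m : ℝ) * p ≤ X ∧ (m : ℝ) * Y ≤ X := by
    intro p _ m hm
    obtain ⟨h1, h2, h3⟩ := Finset.mem_filter.1 hm
    refine ⟨(Finset.mem_Icc.1 h1).1, h3, natCast_mul_le_of_le_pow (by omega) (by linarith) hYX h3 ?_⟩
    have := Nat.le_pow_card_primeFactors h2.squarefree h2.lt_of_mem
    rwa [h2.card_primeFactors] at this
  have hcommon : ∀ m m', m ≠ m' → (P.filter fun p ↦ m ∈ N p ∧ m' ∈ N p).card ≤ 2 * k :=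
    fun m m' hmm ↦ KloostermanEdge.card_common_le hk hf hmm _ fun p hp ↦ by
      obtain ⟨-, h1, h2⟩ := Finset.mem_filter.1 hp
      exact ⟨(Finset.mem_filter.1 h1).2.1, (Finset.mem_filter.1 h2).2.1⟩
  have hkst := sum_card_le_of_card_common_le P N (by omega : 0 < k) hX hY1
    (fun p hp ↦ (Finset.mem_Icc.1 hp).1) hbound hcommon
  have hpi : ((P.filter fun p ↦ (N p).Nonempty).card : ℝ) ≤ primePi (X / (primorialL k : ℝ)) := by
    rw [primePi, ← Set.ncard_coe_finset]
    refine Nat.cast_le.2 (Set.ncard_le_ncard ?_ ((finite_setOf_natCast_le _).subset fun _ h ↦ h.1))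
    intro p hp
    obtain ⟨hp1, m, hm⟩ := Finset.mem_filter.1 hp
    obtain ⟨-, h2, h3⟩ := Finset.mem_filter.1 hm
    refine ⟨(le_div_iff₀ (by exact_mod_cast primorialL_pos k)).2 (le_trans ?_ h3), h2.prime⟩
    rw [mul_comm]
    gcongr
    exact primorialL_le h2.squarefree h2.card_primeFactors
  have hcover : {n ∈ squarefreeAlmostPrimes k X | kloosterman a b n = η * f n} ⊆
      (((B ×ˢ M).image fun x ↦ x.1 * x.2) ∪ ((P.sigma N).image fun x ↦ x.1 * x.2) : Finset ℕ) := by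
    rintro n ⟨hn, hnS⟩
    obtain ⟨hnX, hsq, hcard⟩ := mem_squarefreeAlmostPrimes.1 hn
    have hn1 : n ≠ 1 := by
      rintro rfl
      simp at hcard
      omega
    obtain ⟨p, m, rfl, hp, hmsq, hmc, hlt⟩ := exists_eq_largest_prime_mul hsq hn1
    rw [hcard] at hmc
    have hm1 : 1 ≤ m := Nat.pos_of_ne_zero hmsq.ne_zero
    have hmpX : (m : ℝ) * p ≤ X := by rw [mul_comm]; exact_mod_cast hnX
    have hmle := Nat.le_pow_card_primeFactors hmsq hlt
    rw [hmc] at hmle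
    rw [Finset.mem_coe, Finset.mem_union]
    by_cases hpB : p ∈ B
    · left
      refine Finset.mem_image.2 ⟨(p, m), Finset.mem_product.2 ⟨hpB, Finset.mem_Icc.2 ⟨hm1,
        Nat.le_floor ((le_div_iff₀ (by linarith)).2 ?_)⟩⟩, rfl⟩
      exact natCast_mul_le_of_le_pow (by omega) (by linarith) hYX hmpX hmle
    · right
      have hpn : ¬ p ∣ 6 * a.natAbs * b.natAbs := fun h ↦ hpB (Nat.mem_primeFactors.2
        ⟨hp, h, mul_ne_zero (mul_ne_zero (by norm_num) (Int.natAbs_ne_zero.2 ha))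
          (Int.natAbs_ne_zero.2 hb)⟩)
      have hpX : (p : ℝ) ≤ X := by
        refine le_trans ?_ hnX
        exact_mod_cast Nat.le_mul_of_pos_right p hm1
      have hmX : (m : ℝ) ≤ X := by
        refine le_trans ?_ hnX
        exact_mod_cast Nat.le_mul_of_pos_left m hp.pos
      refine Finset.mem_image.2 ⟨⟨p, m⟩, Finset.mem_sigma.2
        ⟨Finset.mem_Icc.2 ⟨hp.pos, Nat.le_floor hpX⟩, Finset.mem_filter.2
          ⟨Finset.mem_Icc.2 ⟨hm1, Nat.le_floor hmX⟩, ⟨hp, ?_, ?_, ?_, hmsq, hmc, hlt, hnS⟩, hmpX⟩⟩, rfl⟩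
      · by_contra hlt5
        have h2 := hp.two_le
        have hp4 : p < 5 := not_le.1 hlt5
        interval_cases p
        · exact hpn (Dvd.dvd.mul_right (Dvd.dvd.mul_right (by norm_num) _) _)
        · exact hpn (Dvd.dvd.mul_right (Dvd.dvd.mul_right (by norm_num) _) _)
        · exact absurd hp (by norm_num)
      · exact fun h ↦ hpn (Dvd.dvd.mul_right (Dvd.dvd.mul_left (Int.natCast_dvd.1 h) _) _)
      · exact fun h ↦ hpn (Dvd.dvd.mul_left (Int.natCast_dvd.1 h) _)
  have hcard : ({n ∈ squarefreeAlmostPrimes k X | kloosterman a b n = η * f n}.ncard : ℝ) ≤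
      (B.card : ℝ) * M.card + ∑ p ∈ P, ((N p).card : ℝ) := by
    have h1 := Set.ncard_le_ncard hcover (Finset.finite_toSet _)
    rw [Set.ncard_coe_finset] at h1
    have h2 := h1.trans ((Finset.card_union_le _ _).trans
      (Nat.add_le_add Finset.card_image_le Finset.card_image_le))
    rw [Finset.card_product, Finset.card_sigma] at h2
    exact_mod_cast h2
  have hMc : (M.card : ℝ) ≤ X / √Y := by
    rw [hM, Nat.card_Icc, Nat.add_sub_cancel]
    refine (Nat.floor_le (by positivity)).trans ?_
    gcongr
    rw [Real.sqrt_le_left (by linarith)]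
    nlinarith
  have hBc := card_primeFactors_six_mul_le a b
  have ha1 : 1 ≤ |(a : ℝ)| := by exact_mod_cast Int.one_le_abs ha
  have hb1 : 1 ≤ |(b : ℝ)| := by exact_mod_cast Int.one_le_abs hb
  have hBM : (B.card : ℝ) * M.card ≤ 7 * (|(a : ℝ)| + |(b : ℝ)|) * (X / √Y) :=
    mul_le_mul (by linarith) hMc (Nat.cast_nonneg _) (by positivity)
  rw [← hmain]
  calc _ ≤ _ := hcard
    _ ≤ 7 * (|(a : ℝ)| + |(b : ℝ)|) * (X / √Y) +
        (primePi (X / (primorialL k : ℝ)) + 7 * √k * (X / √Y)) := by linarith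
    _ = _ := by ring

/-! ### Chebyshev-type bounds -/

theorem primePi_eq_primeCounting {X : ℝ} (hX : 0 ≤ X) : primePi X = Nat.primeCounting ⌊X⌋₊ := by
  rw [← Nat.primesLE_card_eq_primeCounting, primePi, ← Set.ncard_coe_finset]
  congr 1
  ext p
  simp [Nat.mem_primesLE, Nat.le_floor_iff hX]

theorem primePi_mono {X Y : ℝ} (h : X ≤ Y) : primePi X ≤ primePi Y :=
  Set.ncard_le_ncard (fun _ hp ↦ ⟨hp.1.trans h, hp.2⟩)
    ((finite_setOf_natCast_le _).subset fun _ h ↦ h.1)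

open Filter in
theorem eventually_le_primePi : ∀ᶠ X : ℝ in atTop, X / (4 * Real.log X) ≤ primePi X := by
  have hlog : ∀ᶠ X : ℝ in atTop, Real.log (X + 2) ≤ 1 / 10 * (X + 2) := by
    have := (tendsto_atTop_add_const_right atTop (2 : ℝ) tendsto_id).eventually
      (Real.isLittleO_log_id_atTop.bound (by norm_num : (0 : ℝ) < 1 / 10))
    filter_upwards [this, eventually_ge_atTop 2] with X hX h2
    simp only [id_eq, Real.norm_eq_abs] at hX
    rw [abs_of_pos (by linarith : (0 : ℝ) < X + 2)] at hX
    exact (le_abs_self _).trans hX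
  filter_upwards [hlog, eventually_ge_atTop 3] with X hX h3
  have hl : 0 < Real.log X := Real.log_pos (by linarith)
  rw [primePi_eq_primeCounting (by linarith)]
  refine le_trans ?_ (Chebyshev.pi_ge' (by linarith))
  rw [← div_div]
  gcongr
  nlinarith [Real.log_two_gt_d9]

open Filter in
theorem eventually_le_primePi_div {A : ℝ} (hA : 1 ≤ A) :
    ∀ᶠ X : ℝ in atTop, 1 / (4 * A) * (X / Real.log X) ≤ primePi (X / A) := by
  have h := (tendsto_id.atTop_div_const (by linarith : 0 < A)).eventually eventually_le_primePi
  filter_upwards [h, eventually_gt_atTop A] with X hX hAX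
  refine le_trans ?_ hX
  have hX1 : 1 < X / A := (one_lt_div (by linarith)).2 hAX
  have hl : 0 < Real.log (X / A) := Real.log_pos hX1
  have hle : Real.log (X / A) ≤ Real.log X :=
    Real.log_le_log (by linarith) (div_le_self (by linarith) hA)
  calc 1 / (4 * A) * (X / Real.log X) = X / A / (4 * Real.log X) := by field_simp
    _ ≤ X / A / (4 * Real.log (X / A)) := by
      gcongr

open Filter in
theorem eventually_primePi_le : ∀ᶠ X : ℝ in atTop, (primePi X : ℝ) ≤ 3 * (X / Real.log X) := by
  filter_upwards [Chebyshev.eventually_primeCounting_le one_pos, eventually_gt_atTop 1] with X hX h1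
  rw [primePi_eq_primeCounting (by linarith)]
  refine hX.trans ?_
  rw [mul_div_assoc]
  have hl : 0 < Real.log X := Real.log_pos h1
  have h4 : Real.log 4 ≤ 2 := by
    have : (4 : ℝ) = 2 ^ 2 := by norm_num
    rw [this, Real.log_pow]
    have := Real.log_two_lt_d9
    push_cast
    linarith
  gcongr
  linarith

open Filter in
theorem tendsto_div_log_atTop : Tendsto (fun X : ℝ ↦ X / Real.log X) atTop atTop := by
  have h : Tendsto (fun X : ℝ ↦ Real.log X / X) atTop (nhdsWithin 0 (Set.Ioi 0)) := by
    refine tendsto_nhdsWithin_iff.2 ⟨Real.isLittleO_log_id_atTop.tendsto_div_nhds_zero, ?_⟩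
    filter_upwards [eventually_gt_atTop 1] with X hX
    exact div_pos (Real.log_pos hX) (by linarith)
  exact h.inv_tendsto_nhdsGT_zero.congr fun X ↦ by simp

-- Since log X = o(X^δ), the main term π(X/L_k) absorbs the power-saving error of (i).
open Filter in
theorem eventually_rpow_le_primePi_div {A δ : ℝ} (hA : 1 ≤ A) (hδ : 0 < δ) :
    ∀ᶠ X : ℝ in atTop, X ^ (1 - δ) ≤ primePi (X / A) := by
  have h := (isLittleO_log_rpow_atTop hδ).bound (by positivity : 0 < 1 / (4 * A))
  filter_upwards [h, eventually_le_primePi_div hA, eventually_gt_atTop 1] with X h1 h2 h3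
  refine le_trans ?_ h2
  have hl : 0 < Real.log X := Real.log_pos h3
  have hX : 0 < X := by linarith
  have hXd : 0 < X ^ δ := Real.rpow_pos_of_pos hX _
  rw [Real.norm_of_nonneg hl.le, Real.norm_of_nonneg hXd.le] at h1
  rw [Real.rpow_sub hX, Real.rpow_one, mul_div_assoc', div_le_div_iff₀ hXd hl]
  calc X * Real.log X ≤ X * (1 / (4 * A) * X ^ δ) := by gcongr
    _ = 1 / (4 * A) * X * X ^ δ := by ring

/-! ### Almost primes outnumber primes -/

/-- Euler's divergence of Σ 1/q; dropping the primes up to l costs at most l. -/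
theorem exists_primes_sum_one_div_gt (l : ℕ) (S : ℝ) :
    ∃ Q : Finset ℕ, (∀ q ∈ Q, q.Prime ∧ l < q) ∧ S < ∑ q ∈ Q, 1 / (q : ℝ) := by
  classical
  by_contra! H
  refine not_summable_one_div_on_primes (summable_of_sum_le (c := S + l) (fun n ↦ ?_) fun U ↦ ?_)
  · exact Set.indicator_nonneg (fun _ _ ↦ by positivity) _
  · have h1 : ∑ n ∈ U, Set.indicator {p | p.Prime} (fun n : ℕ ↦ (1 : ℝ) / n) n =
        ∑ n ∈ U.filter Nat.Prime, 1 / (n : ℝ) := by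
      rw [Finset.sum_filter]
      exact Finset.sum_congr rfl fun n _ ↦ by simp [Set.indicator_apply]
    rw [h1, ← Finset.sum_filter_add_sum_filter_not (U.filter Nat.Prime) (fun n ↦ l < n)]
    refine add_le_add (H _ fun q hq ↦ ?_) ?_
    · rw [Finset.mem_filter, Finset.mem_filter] at hq
      exact ⟨hq.1.2, hq.2⟩
    · have hsub : (U.filter Nat.Prime).filter (fun n ↦ ¬ l < n) ⊆ Finset.Icc 1 l := fun q hq ↦ by
        rw [Finset.mem_filter, Finset.mem_filter] at hq
        exact Finset.mem_Icc.2 ⟨hq.1.2.pos, not_lt.1 hq.2⟩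
      calc _ ≤ ∑ n ∈ Finset.Icc 1 l, 1 / (n : ℝ) :=
            Finset.sum_le_sum_of_subset_of_nonneg hsub fun _ _ _ ↦ by positivity
        _ ≤ ∑ n ∈ Finset.Icc 1 l, (1 : ℝ) := by
            refine Finset.sum_le_sum fun n hn ↦ ?_
            have : (1 : ℝ) ≤ n := by exact_mod_cast (Finset.mem_Icc.1 hn).1
            exact (div_le_one (by linarith)).2 this
        _ = l := by simp

theorem primorialL_eq_prod_image (k : ℕ) :
    primorialL k = ∏ p ∈ (Finset.range (k - 1)).image (Nat.nth Nat.Prime), p := by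
  rw [primorialL, Finset.prod_image]
  exact fun i _ j _ h ↦ Nat.nth_injective Nat.infinite_setOfPred_prime h

theorem squarefree_primorialL (k : ℕ) : Squarefree (primorialL k) := by
  rw [primorialL]
  refine Finset.squarefree_prod_of_pairwise_isCoprime (fun i _ j _ hij ↦ ?_)
    fun i _ ↦ (Nat.prime_nth_prime i).squarefree
  rw [Function.onFun, ← Nat.coprime_iff_isRelPrime]
  exact (Nat.coprime_primes (Nat.prime_nth_prime i) (Nat.prime_nth_prime j)).2
    ((Nat.nth_injective Nat.infinite_setOfPred_prime).ne hij)

theorem card_primeFactors_primorialL (k : ℕ) : (primorialL k).primeFactors.card = k - 1 := by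
  rw [primorialL_eq_prod_image, Nat.primeFactors_prod, Finset.card_image_of_injective,
    Finset.card_range]
  · exact Nat.nth_injective Nat.infinite_setOfPred_prime
  · intro p hp
    obtain ⟨i, -, rfl⟩ := Finset.mem_image.1 hp
    exact Nat.prime_nth_prime i

/-- A lower bound for the number of square-free `n ≤ X` with `k` prime factors, counting those of
the form `l * q * p` with `l` the product of the first `k - 2` primes. -/
theorem sum_primePi_le_ncard {k : ℕ} (hk : 2 ≤ k) (Q : Finset ℕ) (Z : ℕ)
    (hQ : ∀ q ∈ Q, q.Prime ∧ primorialL (k - 1) < q ∧ q ≤ Z) (X : ℝ) :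
    ∑ q ∈ Q, ((primePi (X / (primorialL (k - 1) * q : ℕ)) : ℝ) - Z) ≤
      (squarefreeAlmostPrimes k X).ncard := by
  classical
  set l := primorialL (k - 1) with hl
  have hl0 : 0 < l := primorialL_pos _
  -- Requiring p > Z costs at most Z primes and gives l < q ≤ Z < p, so l q p is square-free and
  -- determines q and p.
  set R : ℕ → Finset ℕ := fun q ↦
    (Finset.Icc (Z + 1) ⌊X / (l * q : ℕ)⌋₊).filter Nat.Prime with hR
  have hcard : ∀ q ∈ Q, (primePi (X / (l * q : ℕ)) : ℝ) - Z ≤ (R q).card := by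
    intro q _
    have hsub : {p : ℕ | (p : ℝ) ≤ X / (l * q : ℕ) ∧ p.Prime} ⊆
        ((R q ∪ Finset.Icc 1 Z : Finset ℕ) : Set ℕ) := by
      rintro p ⟨hp, hpp⟩
      rw [Finset.mem_coe, Finset.mem_union, hR, Finset.mem_filter, Finset.mem_Icc, Finset.mem_Icc]
      rcases le_or_gt p Z with h | h
      · exact Or.inr ⟨hpp.pos, h⟩
      · exact Or.inl ⟨⟨h, Nat.le_floor hp⟩, hpp⟩
    have h := (Set.ncard_le_ncard hsub (Finset.finite_toSet _))
    rw [Set.ncard_coe_finset] at h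
    have h' := h.trans (Finset.card_union_le _ _)
    rw [Nat.card_Icc, Nat.add_sub_cancel] at h'
    rw [sub_le_iff_le_add]
    exact_mod_cast h'
  have hmaps : (((Q.sigma R).image fun x ↦ l * x.1 * x.2 : Finset ℕ) : Set ℕ) ⊆
      squarefreeAlmostPrimes k X := by
    intro n hn
    obtain ⟨⟨q, p⟩, hx, rfl⟩ := Finset.mem_image.1 hn
    obtain ⟨hq, hp⟩ := Finset.mem_sigma.1 hx
    obtain ⟨hp1, hpp⟩ := Finset.mem_filter.1 hp
    obtain ⟨hZp, hpX⟩ := Finset.mem_Icc.1 hp1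
    obtain ⟨hqp, hlq, hqZ⟩ := hQ q hq
    have c1 : Nat.Coprime l q := ((Nat.Prime.coprime_iff_not_dvd hqp).2
      fun h ↦ absurd (Nat.le_of_dvd hl0 h) (by omega)).symm
    have c2 : Nat.Coprime (l * q) p := by
      refine ((Nat.Prime.coprime_iff_not_dvd hpp).2 fun h ↦ ?_).symm
      rcases (Nat.Prime.dvd_mul hpp).1 h with h | h
      · have := Nat.le_of_dvd hl0 h
        simp only at *
        omega
      · have := Nat.le_of_dvd hqp.pos h
        simp only at *
        omega
    refine mem_squarefreeAlmostPrimes.2 ⟨?_, ?_, ?_⟩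
    · have h1 : (p : ℝ) ≤ X / (l * q : ℕ) := (Nat.le_floor_iff' hpp.ne_zero).1 hpX
      rw [le_div_iff₀ (by exact_mod_cast Nat.mul_pos hl0 hqp.pos)] at h1
      push_cast at h1 ⊢
      linarith
    · exact (Nat.squarefree_mul c2).2
        ⟨(Nat.squarefree_mul c1).2 ⟨squarefree_primorialL _, hqp.squarefree⟩, hpp.squarefree⟩
    · rw [c2.primeFactors_mul, c1.primeFactors_mul, Finset.card_union_of_disjoint,
        Finset.card_union_of_disjoint, card_primeFactors_primorialL, hqp.primeFactors,
        hpp.primeFactors, Finset.card_singleton, Finset.card_singleton]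
      · omega
      · exact c1.disjoint_primeFactors
      · rw [← c1.primeFactors_mul]
        exact c2.disjoint_primeFactors
  have hinj : Set.InjOn (fun x : (_ : ℕ) × ℕ ↦ l * x.1 * x.2) (Q.sigma R : Finset _) := by
    rintro ⟨q, p⟩ hx ⟨q', p'⟩ hx' h
    simp only [Finset.mem_coe, Finset.mem_sigma, hR, Finset.mem_filter, Finset.mem_Icc] at hx hx'
    obtain ⟨hq, ⟨hp1, -⟩, hp⟩ := hx
    obtain ⟨hq', ⟨hp1', -⟩, hp'⟩ := hx'
    obtain ⟨hqp, hlq, hqZ⟩ := hQ q hq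
    obtain ⟨hqp', hlq', hqZ'⟩ := hQ q' hq'
    simp only [mul_assoc] at h
    have h := Nat.eq_of_mul_eq_mul_left hl0 h
    have hdvd : p ∣ q' * p' := ⟨q, by rw [← h, mul_comm]⟩
    have hpp : p = p' := by
      rcases (Nat.Prime.dvd_mul hp).1 hdvd with h | h
      · have := Nat.le_of_dvd hqp'.pos h
        omega
      · exact (Nat.prime_dvd_prime_iff_eq hp hp').1 h
    subst hpp
    have hqq : q = q' := Nat.eq_of_mul_eq_mul_right hp.pos h
    subst hqq
    rfl
  calc _ ≤ ∑ q ∈ Q, ((R q).card : ℝ) := Finset.sum_le_sum hcard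
    _ = ((Q.sigma R).card : ℝ) := by rw [Finset.card_sigma]; push_cast; rfl
    _ = (((Q.sigma R).image fun x ↦ l * x.1 * x.2).card : ℝ) := by
        rw [Finset.card_image_of_injOn hinj]
    _ ≤ _ := by
        rw [← Set.ncard_coe_finset]
        exact Nat.cast_le.2 (Set.ncard_le_ncard hmaps (finite_squarefreeAlmostPrimes k X))

-- A fixed finite set of primes q, each contributing at least about X/(4 l q log X) products, yields
-- as large a multiple of X/log X as desired once Σ 1/q is large.
open Filter in
theorem eventually_primePi_le_mul_ncard {k : ℕ} (hk : 2 ≤ k) {ε : ℝ} (hε : 0 < ε) :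
    ∀ᶠ X : ℝ in atTop, (primePi X : ℝ) ≤ ε * (squarefreeAlmostPrimes k X).ncard := by
  set l := primorialL (k - 1) with hl
  have hl0 : 0 < l := primorialL_pos _
  have hl0' : (0 : ℝ) < l := by exact_mod_cast hl0
  -- The factor 4l cancels the one in the lower bound for π(X/(lq)), 3/ε meets the upper bound
  -- 3X/log X for π(X), and the extra 1 pays for the loss |Q| Z.
  obtain ⟨Q, hQ, hS⟩ := exists_primes_sum_one_div_gt l (4 * l * (3 / ε + 1))
  set Z := Q.sup id
  have hpi : ∀ᶠ X : ℝ in atTop, ∀ q ∈ Q,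
      1 / (4 * ((l * q : ℕ) : ℝ)) * (X / Real.log X) ≤ primePi (X / (l * q : ℕ)) := by
    rw [Finset.eventually_all]
    intro q hq
    refine eventually_le_primePi_div ?_
    exact_mod_cast Nat.mul_pos hl0 (hQ q hq).1.pos
  filter_upwards [hpi, eventually_primePi_le,
    tendsto_div_log_atTop.eventually_ge_atTop ((Q.card : ℝ) * Z),
    tendsto_div_log_atTop.eventually_ge_atTop 0] with X h1 h2 h3 h4
  have h5 := sum_primePi_le_ncard hk Q Z
    (fun q hq ↦ ⟨(hQ q hq).1, (hQ q hq).2, Finset.le_sup (f := id) hq⟩) X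
  set h := X / Real.log X
  have h6 : (3 / ε + 1) * h - Q.card * Z ≤ (squarefreeAlmostPrimes k X).ncard := by
    refine le_trans ?_ h5
    rw [Finset.sum_sub_distrib, Finset.sum_const, nsmul_eq_mul]
    refine sub_le_sub_right ?_ _
    calc (3 / ε + 1) * h = 1 / (4 * l) * (4 * l * (3 / ε + 1)) * h := by field_simp
      _ ≤ 1 / (4 * l) * (∑ q ∈ Q, 1 / (q : ℝ)) * h := by gcongr
      _ = ∑ q ∈ Q, 1 / (4 * ((l * q : ℕ) : ℝ)) * h := by
          rw [Finset.mul_sum, Finset.sum_mul]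
          refine Finset.sum_congr rfl fun q _ ↦ ?_
          push_cast
          rw [one_div_mul_one_div]
          ring_nf
      _ ≤ _ := Finset.sum_le_sum h1
  calc (primePi X : ℝ) ≤ 3 * h := h2
    _ = ε * (3 / ε * h) := by field_simp
    _ ≤ ε * (squarefreeAlmostPrimes k X).ncard := by
        gcongr
        linarith

/-! ### Passing to complements and conclusion -/

theorem ncard_sep_ne_add_ncard_sep_eq (k : ℕ) (X : ℝ) (F G : ℕ → ℂ) :
    ({n ∈ squarefreeAlmostPrimes k X | F n ≠ G n}.ncard : ℝ) =
      (squarefreeAlmostPrimes k X).ncard -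
        ({n ∈ squarefreeAlmostPrimes k X | F n = G n}.ncard : ℝ) := by
  have h := Set.ncard_sdiff_add_ncard_of_subset (s := {n ∈ squarefreeAlmostPrimes k X | F n = G n})
    (t := squarefreeAlmostPrimes k X) (Set.sep_subset _ _) (finite_squarefreeAlmostPrimes k X)
  have h' : squarefreeAlmostPrimes k X \ {n ∈ squarefreeAlmostPrimes k X | F n = G n} =
      {n ∈ squarefreeAlmostPrimes k X | F n ≠ G n} := by
    ext n
    simp only [Set.mem_sdiff, Set.mem_sep_iff]
    tauto
  rw [h'] at h
  rw [eq_sub_iff_add_eq]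
  exact_mod_cast h

theorem theorem1 (a b : ℤ) (ha : a ≠ 0) (hb : b ≠ 0) (k : ℕ) (hk : 2 ≤ k) :
    -- the upper bound, for all `X ≥ 1`
    (∀ (η : ℂ) (f : ArithmeticFunction ℂ), η ≠ 0 → f.IsMultiplicative → ∀ X : ℝ, 1 ≤ X →
      ({n ∈ squarefreeAlmostPrimes k X | kloosterman a b n = η * f n}.ncard : ℝ) ≤
        (primePi (X / (primorialL k : ℝ)) : ℝ) +
          7 * (|(a : ℝ)| + |(b : ℝ)| + √(k : ℝ)) * X ^ (1 - 1 / (2 * (k : ℝ)))) ∧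
    -- the asymptotic formula, with constants that depend on `a`, `b`, `k` only
    (∃ C X₀ : ℝ, ∀ (η : ℂ) (f : ArithmeticFunction ℂ), η ≠ 0 → f.IsMultiplicative →
      ∀ X : ℝ, X₀ ≤ X →
        |({n ∈ squarefreeAlmostPrimes k X | kloosterman a b n ≠ η * f n}.ncard : ℝ) -
            ((squarefreeAlmostPrimes k X).ncard : ℝ)| ≤
          C * (primePi (X / (primorialL k : ℝ)) : ℝ)) ∧
    -- `100%` of the square-free `k`-almost primes
    (∀ (η : ℂ) (f : ArithmeticFunction ℂ), η ≠ 0 → f.IsMultiplicative →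
      Filter.Tendsto
        (fun X : ℝ =>
          ({n ∈ squarefreeAlmostPrimes k X | kloosterman a b n ≠ η * f n}.ncard : ℝ) /
            ((squarefreeAlmostPrimes k X).ncard : ℝ))
        Filter.atTop (nhds 1)) := by
  have hL1 : (1 : ℝ) ≤ primorialL k := by exact_mod_cast primorialL_pos k
  have hk0 : (0 : ℝ) < k := by exact_mod_cast (by omega : 0 < k)
  set D : ℝ := 7 * (|(a : ℝ)| + |(b : ℝ)| + √(k : ℝ)) with hD
  have hD0 : 0 ≤ D := by positivity
  -- The quantifiers over η and f stand inside the eventuality: the threshold comes only from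
  -- comparing X^(1-1/(2k)) with π(X/L_k).
  have hbound : ∀ᶠ X : ℝ in Filter.atTop, ∀ (η : ℂ) (f : ArithmeticFunction ℂ),
      f.IsMultiplicative →
      ({n ∈ squarefreeAlmostPrimes k X | kloosterman a b n = η * f n}.ncard : ℝ) ≤
        (1 + D) * primePi (X / (primorialL k : ℝ)) := by
    filter_upwards [eventually_rpow_le_primePi_div hL1 (by positivity : 0 < 1 / (2 * (k : ℝ))),
      Filter.eventually_ge_atTop 1] with X h1 h2 η f hf
    refine (ncard_kloosterman_eq_le ha hb hk η hf h2).trans ?_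
    rw [add_mul, one_mul]
    gcongr
  refine ⟨fun η f _ hf X hX ↦ ncard_kloosterman_eq_le ha hb hk η hf hX, ?_, fun η f _ hf ↦ ?_⟩
  · obtain ⟨X₀, hX₀⟩ := Filter.eventually_atTop.1 hbound
    refine ⟨1 + D, X₀, fun η f _ hf X hX ↦ ?_⟩
    rw [ncard_sep_ne_add_ncard_sep_eq k X (kloosterman a b) (fun n ↦ η * f n), sub_sub_cancel_left,
      abs_neg, Nat.abs_cast]
    exact hX₀ X hX η f hf
  · have hzero : Filter.Tendsto (fun X : ℝ ↦
        ({n ∈ squarefreeAlmostPrimes k X | kloosterman a b n = η * f n}.ncard : ℝ) /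
          ((squarefreeAlmostPrimes k X).ncard : ℝ)) Filter.atTop (nhds 0) := by
      rw [Metric.tendsto_nhds]
      intro ε hε
      filter_upwards [hbound, eventually_primePi_le_mul_ncard hk
        (by positivity : 0 < ε / (2 * (1 + D))), Filter.eventually_ge_atTop 0] with X h1 h2 h3
      rw [Real.dist_0_eq_abs, abs_of_nonneg (by positivity)]
      refine lt_of_le_of_lt (div_le_of_le_mul₀ (Nat.cast_nonneg _) (half_pos hε).le ?_)
        (half_lt_self hε)
      calc _ ≤ (1 + D) * primePi (X / (primorialL k : ℝ)) := h1 η f hf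
        _ ≤ (1 + D) * primePi X := by
            gcongr
            exact primePi_mono (div_le_self h3 hL1)
        _ ≤ (1 + D) * (ε / (2 * (1 + D)) * (squarefreeAlmostPrimes k X).ncard) := by gcongr
        _ = ε / 2 * (squarefreeAlmostPrimes k X).ncard := by field_simp
    have hone := (tendsto_const_nhds (x := (1 : ℝ))).sub hzero
    rw [sub_zero] at hone
    refine hone.congr' ?_
    -- The case ε = 1 gives 0 < π(X) ≤ π_k(X), so the quotient by π_k(X) is a genuine one.
    filter_upwards [eventually_primePi_le_mul_ncard hk one_pos, Filter.eventually_ge_atTop 2]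
      with X h1 h2
    have hpos : (0 : ℝ) < (squarefreeAlmostPrimes k X).ncard := by
      have : 0 < primePi X := (Set.ncard_pos
        ((finite_setOf_natCast_le X).subset fun _ h ↦ h.1)).2 ⟨2, by exact_mod_cast h2, Nat.prime_two⟩
      have : (0 : ℝ) < primePi X := by exact_mod_cast this
      linarith
    rw [ncard_sep_ne_add_ncard_sep_eq k X (kloosterman a b) (fun n ↦ η * f n), sub_div,
      div_self hpos.ne']
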